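/- For a measurable function $V:\mathbb R\to[0,\infty)$ let $\mathbf Z_V=-\frac{d^2}{dx^2}+V$ denote the Schrödinger operator on $L^2(\mathbb R)$ defined by the closed quadratic form $\int_{\mathbb R}\bigl(|u'|^2+V|u|^2\bigr)\,dx$ with domain $Q(V)=\{u\in H^1(\mathbb R):\int_{\mathbb R} V|u|^2\,dx<\infty\}$. (If $Q(V)$ is not dense in $L^2(\mathbb R)$, $\mathbf Z_V$ is understood as the operator of this form in the closure of $Q(V)$, and $\mathbf Z_V^{-1}$ is extended by zero to the orthogonal complement.) Let $\epsilon_0>0$, let $V$ and $V_\epsilon$, $0<\epsilon\le\epsilon_0$, be non-negative measurable functions on $\mathbb R$ such that $V(x)\to\infty$ as $|x|\to\infty$ and $V_\epsilon\to V$ as $\epsilon\to0$ uniformly on compact sets. Suppose also that $$V_\epsilon(x)\ge V^\circ_\epsilon(x)\qquad\text{for all }x\in\mathbb R,\ 0<\epsilon\le\epsilon_0,$$ where $V^\circ_\epsilon$, $0<\epsilon\le\epsilon_0$, are real-valued measurable functions on $\mathbb R$ which are monotone in $\epsilon$, that is, $V^\circ_{\epsilon_1}(x)\le V^\circ_{\epsilon_2}(x)$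 for all $x\in\mathbb R$ whenever $\epsilon_1>\epsilon_2$, and for which $$c(\epsilon):=\liminf_{|x|\to\infty}V^\circ_\epsilon(x)\to\infty\qquad\text{as }\epsilon\to0.$$ Then $\mathbf Z_V$ has a bounded inverse, $\mathbf Z_{V_\epsilon}$ has a bounded inverse for all sufficiently small $\epsilon>0$, and $$\|\mathbf Z_{V_\epsilon}^{-1}-\mathbf Z_V^{-1}\|\to0\qquad\text{as }\epsilon\to0.$$ -/

import Mathlib

open MeasureTheory Filter Topology Set
open scoped NNReal ENNReal ContDiff InnerProductSpace

noncomputable section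

namespace Schrodinger1D

/-- The Hilbert space `L²(ℝ)` of (classes of) `𝕜`-valued functions, `𝕜 = ℝ` or `ℂ`. -/
abbrev L2 (𝕜 : Type*) [RCLike 𝕜] : Type _ := Lp 𝕜 2 (volume : Measure ℝ)

variable {𝕜 : Type*} [RCLike 𝕜]

/-- `g ∈ L²(ℝ)` is the weak derivative of `u ∈ L²(ℝ)`. -/
def IsWeakDeriv (u g : L2 𝕜) : Prop :=
  ∀ φ : ℝ → ℝ, ContDiff ℝ ∞ φ → HasCompactSupport φ →
    ∫ x, deriv φ x • u x = - ∫ x, φ x • g x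

theorem integrable_smul_test (φ : ℝ → ℝ) (hφ : Continuous φ) (hc : HasCompactSupport φ)
    (u : L2 𝕜) : Integrable (fun x => φ x • u x) := by
  have h : LocallyIntegrable (u : ℝ → 𝕜) :=
    (Lp.memLp u).locallyIntegrable (by norm_num)
  exact h.integrable_smul_left_of_hasCompactSupport hφ hc

theorem IsWeakDeriv.add {u g v k : L2 𝕜} (hu : IsWeakDeriv u g) (hv : IsWeakDeriv v k) :
    IsWeakDeriv (u + v) (g + k) := by
  intro φ hφ hc
  have hd : Continuous (deriv φ) := hφ.continuous_deriv (by simp)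
  have e1 : ∫ x, deriv φ x • (u + v : L2 𝕜) x = ∫ x, (deriv φ x • u x + deriv φ x • v x) := by
    refine integral_congr_ae ?_
    filter_upwards [Lp.coeFn_add u v] with x hx
    rw [hx, Pi.add_apply, smul_add]
  have e2 : ∫ x, φ x • (g + k : L2 𝕜) x = ∫ x, (φ x • g x + φ x • k x) := by
    refine integral_congr_ae ?_
    filter_upwards [Lp.coeFn_add g k] with x hx
    rw [hx, Pi.add_apply, smul_add]
  rw [e1, e2, integral_add (integrable_smul_test _ hd hc.deriv u)
    (integrable_smul_test _ hd hc.deriv v), integral_add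
    (integrable_smul_test _ hφ.continuous hc g) (integrable_smul_test _ hφ.continuous hc k),
    hu φ hφ hc, hv φ hφ hc, neg_add]

theorem IsWeakDeriv.smul {u g : L2 𝕜} (c : 𝕜) (hu : IsWeakDeriv u g) :
    IsWeakDeriv (c • u) (c • g) := by
  intro φ hφ hc
  have e1 : ∫ x, deriv φ x • (c • u : L2 𝕜) x = ∫ x, c • (deriv φ x • u x) := by
    refine integral_congr_ae ?_
    filter_upwards [Lp.coeFn_smul c u] with x hx
    rw [hx, Pi.smul_apply, smul_comm]
  have e2 : ∫ x, φ x • (c • g : L2 𝕜) x = ∫ x, c • (φ x • g x) := by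
    refine integral_congr_ae ?_
    filter_upwards [Lp.coeFn_smul c g] with x hx
    rw [hx, Pi.smul_apply, smul_comm]
  rw [e1, e2, integral_smul, integral_smul, hu φ hφ hc, smul_neg]

theorem isWeakDeriv_zero : IsWeakDeriv (0 : L2 𝕜) 0 := by
  simpa using (show IsWeakDeriv ((0 : 𝕜) • (0 : L2 𝕜)) ((0 : 𝕜) • 0) from by
    intro φ _ _
    have e : ∀ ψ : ℝ → ℝ, ∫ x, ψ x • ((0 : 𝕜) • (0 : L2 𝕜)) x = 0 := by
      intro ψ
      rw [zero_smul]
      refine integral_eq_zero_of_ae ?_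
      filter_upwards [Lp.coeFn_zero 𝕜 2 (volume : Measure ℝ)] with x hx
      rw [hx]
      simp
    rw [e, e, neg_zero])

theorem IsWeakDeriv.unique {u g k : L2 𝕜} (hg : IsWeakDeriv u g) (hk : IsWeakDeriv u k) :
    g = k := by
  refine Lp.ext ?_
  have hl : ∀ w : L2 𝕜, LocallyIntegrable (w : ℝ → 𝕜) := fun w =>
    (Lp.memLp w).locallyIntegrable (by norm_num)
  refine ae_eq_of_integral_contDiff_smul_eq (hl g) (hl k) ?_
  intro φ hφ hc
  exact neg_injective ((hg φ hφ hc).symm.trans (hk φ hφ hc))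

/-- The Sobolev space `H¹(ℝ)`, as a subspace of `L²(ℝ)`. -/
def H1 (𝕜 : Type*) [RCLike 𝕜] : Submodule 𝕜 (L2 𝕜) where
  carrier := {u | ∃ g : L2 𝕜, IsWeakDeriv u g}
  add_mem' := by
    rintro u v ⟨g, hg⟩ ⟨k, hk⟩
    exact ⟨g + k, hg.add hk⟩
  zero_mem' := ⟨0, isWeakDeriv_zero⟩
  smul_mem' := by
    rintro c u ⟨g, hg⟩
    exact ⟨c • g, hg.smul c⟩

/-- The weak derivative `H¹(ℝ) → L²(ℝ)`, `u ↦ u'`. -/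
def weakDeriv : H1 𝕜 →ₗ[𝕜] L2 𝕜 where
  toFun u := u.2.choose
  map_add' u v := IsWeakDeriv.unique (u + v).2.choose_spec (u.2.choose_spec.add v.2.choose_spec)
  map_smul' c u := IsWeakDeriv.unique (c • u).2.choose_spec (u.2.choose_spec.smul c)

theorem isWeakDeriv_weakDeriv (u : H1 𝕜) : IsWeakDeriv (u : L2 𝕜) (weakDeriv u) :=
  u.2.choose_spec

/-- The form domain `{u ∈ H¹(ℝ) : ∫ V |u|² < ∞}`. The finiteness condition is expressed by
`√V u ∈ L²(ℝ)`. -/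
def formDomain (𝕜 : Type*) [RCLike 𝕜] (V : ℝ → ℝ≥0) : Submodule 𝕜 (H1 𝕜) where
  carrier := {u | MemLp (fun x => √(V x : ℝ) • (u : L2 𝕜) x) 2 volume}
  add_mem' := by
    intro u v hu hv
    refine (memLp_congr_ae ?_).1 (MemLp.add hu hv)
    filter_upwards [Lp.coeFn_add (u : L2 𝕜) (v : L2 𝕜)] with x hx
    rw [Submodule.coe_add, hx, Pi.add_apply, Pi.add_apply, smul_add]
  zero_mem' := by
    refine (memLp_congr_ae ?_).1 (MemLp.zero : MemLp (0 : ℝ → 𝕜) 2 volume)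
    filter_upwards [Lp.coeFn_zero 𝕜 2 (volume : Measure ℝ)] with x hx
    rw [Submodule.coe_zero, hx]
    simp
  smul_mem' := by
    intro c u hu
    refine (memLp_congr_ae ?_).1 (MemLp.const_smul hu c)
    filter_upwards [Lp.coeFn_smul c (u : L2 𝕜)] with x hx
    rw [Submodule.coe_smul, hx, Pi.smul_apply, Pi.smul_apply, smul_comm]

/-- The sesquilinear form `∫ (u' v̄' + V u v̄)` on the form domain (conjugate-linear in its first
argument, as is Mathlib's inner product). Its quadratic form is `∫ (|u'|² + V |u|²)`. -/
def form (V : ℝ → ℝ≥0) (v u : formDomain 𝕜 V) : 𝕜 :=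
  ⟪weakDeriv v.1, weakDeriv u.1⟫_𝕜 +
    ∫ x, ((V x : ℝ) : 𝕜) * ⟪((v : H1 𝕜) : L2 𝕜) x, ((u : H1 𝕜) : L2 𝕜) x⟫_𝕜

theorem integrable_potential (V : ℝ → ℝ≥0) (v u : formDomain 𝕜 V) :
    Integrable (fun x =>
      ((V x : ℝ) : 𝕜) * ⟪((v : H1 𝕜) : L2 𝕜) x, ((u : H1 𝕜) : L2 𝕜) x⟫_𝕜) := by
  have h := L2.integrable_inner (𝕜 := 𝕜) (MemLp.toLp _ v.2) (MemLp.toLp _ u.2)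
  refine h.congr ?_
  filter_upwards [MemLp.coeFn_toLp v.2, MemLp.coeFn_toLp u.2] with x h1 h2
  have hs : ((V x : ℝ) : 𝕜) = ((√(V x : ℝ) : ℝ) : 𝕜) * ((√(V x : ℝ) : ℝ) : 𝕜) := by
    rw [← RCLike.ofReal_mul, Real.mul_self_sqrt (V x).coe_nonneg]
  rw [h1, h2, hs, RCLike.real_smul_eq_coe_smul (K := 𝕜), RCLike.real_smul_eq_coe_smul (K := 𝕜),
    inner_smul_left, inner_smul_right, RCLike.conj_ofReal, mul_assoc]

theorem form_add (V : ℝ → ℝ≥0) (v u w : formDomain 𝕜 V) :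
    form V v (u + w) = form V v u + form V v w := by
  have e : ∫ x, ((V x : ℝ) : 𝕜) *
        ⟪((v : H1 𝕜) : L2 𝕜) x, (((u + w : formDomain 𝕜 V) : H1 𝕜) : L2 𝕜) x⟫_𝕜 =
      ∫ x, (((V x : ℝ) : 𝕜) * ⟪((v : H1 𝕜) : L2 𝕜) x, ((u : H1 𝕜) : L2 𝕜) x⟫_𝕜 +
        ((V x : ℝ) : 𝕜) * ⟪((v : H1 𝕜) : L2 𝕜) x, ((w : H1 𝕜) : L2 𝕜) x⟫_𝕜) := by
    refine integral_congr_ae ?_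
    filter_upwards [Lp.coeFn_add ((u : H1 𝕜) : L2 𝕜) ((w : H1 𝕜) : L2 𝕜)] with x hx
    rw [Submodule.coe_add, Submodule.coe_add, hx, Pi.add_apply, inner_add_right, mul_add]
  rw [form, e, integral_add (integrable_potential V v u) (integrable_potential V v w),
    Submodule.coe_add, map_add, inner_add_right, form, form]
  ring

theorem form_smul (V : ℝ → ℝ≥0) (c : 𝕜) (v u : formDomain 𝕜 V) :
    form V v (c • u) = c * form V v u := by
  have e : ∫ x, ((V x : ℝ) : 𝕜) *
        ⟪((v : H1 𝕜) : L2 𝕜) x, (((c • u : formDomain 𝕜 V) : H1 𝕜) : L2 𝕜) x⟫_𝕜 =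
      ∫ x, c * (((V x : ℝ) : 𝕜) * ⟪((v : H1 𝕜) : L2 𝕜) x, ((u : H1 𝕜) : L2 𝕜) x⟫_𝕜) := by
    refine integral_congr_ae ?_
    filter_upwards [Lp.coeFn_smul c ((u : H1 𝕜) : L2 𝕜)] with x hx
    rw [Submodule.coe_smul, Submodule.coe_smul, hx, Pi.smul_apply, inner_smul_right, mul_left_comm]
  rw [form, e, integral_const_mul, Submodule.coe_smul, map_smul, inner_smul_right, form, mul_add]

/-- The form domain, seen inside `L²(ℝ)`. -/
def formDomainL2 (𝕜 : Type*) [RCLike 𝕜] (V : ℝ → ℝ≥0) : Submodule 𝕜 (L2 𝕜) :=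
  (formDomain 𝕜 V).map (H1 𝕜).subtype

/-- The graph of the Schrödinger operator `-d²/dx² + V`: the pairs `(u, f)` such that `u` lies in
the form domain, `f` in the closure of the form domain in `L²(ℝ)` (which is `L²(ℝ)` if the form is
densely defined), and `form V v u = ⟪v, f⟫` for all `v` in the form domain. -/
def schrodingerGraph (𝕜 : Type*) [RCLike 𝕜] (V : ℝ → ℝ≥0) : Submodule 𝕜 (L2 𝕜 × L2 𝕜) where
  carrier := {p | p.2 ∈ (formDomainL2 𝕜 V).topologicalClosure ∧
    ∃ u : formDomain 𝕜 V, ((u : H1 𝕜) : L2 𝕜) = p.1 ∧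
      ∀ v : formDomain 𝕜 V, form V v u = ⟪((v : H1 𝕜) : L2 𝕜), p.2⟫_𝕜}
  add_mem' := by
    rintro p q ⟨hp, u, hu, h⟩ ⟨hq, w, hw, k⟩
    refine ⟨Submodule.add_mem _ hp hq, u + w, ?_, fun v => ?_⟩
    · rw [Submodule.coe_add, Submodule.coe_add, hu, hw, Prod.fst_add]
    · rw [form_add, h, k, Prod.snd_add, inner_add_right]
  zero_mem' := by
    refine ⟨Submodule.zero_mem _, 0, rfl, fun v => ?_⟩
    have h := form_smul V 0 v 0
    rw [smul_zero, zero_mul] at h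
    rw [h, Prod.snd_zero, inner_zero_right]
  smul_mem' := by
    rintro c p ⟨hp, u, hu, h⟩
    refine ⟨Submodule.smul_mem _ c hp, c • u, ?_, fun v => ?_⟩
    · rw [Submodule.coe_smul, Submodule.coe_smul, hu, Prod.smul_fst]
    · rw [form_smul, h, Prod.smul_snd, inner_smul_right]

theorem schrodingerGraph_single_valued (V : ℝ → ℝ≥0) (p : L2 𝕜 × L2 𝕜)
    (hp : p ∈ schrodingerGraph 𝕜 V) (h0 : p.1 = 0) : p.2 = 0 := by
  obtain ⟨hc, u, hu, h⟩ := hp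
  have hu0 : u = 0 := Subtype.ext (Subtype.ext (hu.trans h0))
  have hz : ∀ v : formDomain 𝕜 V, ⟪((v : H1 𝕜) : L2 𝕜), p.2⟫_𝕜 = 0 := by
    intro v
    have h1 := form_smul V 0 v 0
    rw [smul_zero, zero_mul] at h1
    rw [← h v, hu0, h1]
  have ho : p.2 ∈ (formDomainL2 𝕜 V)ᗮ := by
    rw [Submodule.mem_orthogonal]
    rintro _ ⟨v, hv, rfl⟩
    exact hz ⟨v, hv⟩
  rw [← Submodule.orthogonal_closure] at ho
  exact inner_self_eq_zero.1 ((Submodule.mem_orthogonal _ _).1 ho _ hc)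

/-- The Schrödinger operator `Z_V = -d²/dx² + V` in `L²(ℝ)`, defined through its quadratic form:
`u` is in its domain and `Z_V u = f` if and only if `(u, f)` belongs to `schrodingerGraph 𝕜 V`. -/
def schrodingerOp (𝕜 : Type*) [RCLike 𝕜] (V : ℝ → ℝ≥0) : L2 𝕜 →ₗ.[𝕜] L2 𝕜 :=
  (schrodingerGraph 𝕜 V).toLinearPMap

theorem schrodingerOp_graph (V : ℝ → ℝ≥0) :
    (schrodingerOp 𝕜 V).graph = schrodingerGraph 𝕜 V :=
  Submodule.toLinearPMap_graph_eq _ (schrodingerGraph_single_valued V)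

/-- `T` is the bounded inverse of the unbounded operator `Z`. If `Z` is densely defined, this says
that `T` is bounded and everywhere defined, with `T Z = 1` on the domain of `Z` and `Z T = 1`
(the third condition is then void). In general `Z` is regarded as an operator in the closure of
its domain, and its inverse there is extended by zero to the orthogonal complement. -/
structure IsBoundedInverse {H : Type*} [NormedAddCommGroup H] [InnerProductSpace 𝕜 H]
    (Z : H →ₗ.[𝕜] H) (T : H →L[𝕜] H) : Prop where
  left_inv : ∀ u : Z.domain, T (Z u) = u
  right_inv : ∀ f ∈ Z.domain.topologicalClosure, ∃ h : T f ∈ Z.domain, Z ⟨T f, h⟩ = f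
  zero_on_orthogonal : ∀ f ∈ Z.domainᗮ, T f = 0

end Schrodinger1D

end

/-!
The operator `T = Z_V⁻¹` is obtained from the form: as soon as the form `‖u'‖² + ∫ V |u|²` controls
`‖u‖²`, the map `u ↦ (u', √V u)` from the form domain to `L² × L²` is injective with closed range
and its inverse `S` is bounded, so that `T = S S*` solves the weak equation `(-d²/dx² + V) u = f`
for every `f ∈ L²` (`IsCoerciveForm.exists_solution_operator`). This operator is the bounded inverse
in the required sense, also when the form domain is not dense
(`isBoundedInverse_of_solution_operator`).

A lower bound for the form, with one constant `C` for `V` and all `V_ε` with small `ε`, holds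
because all these potentials are at least `1` off a common interval
(`exists_uniform_lower_bound`), while the mass of `u` on that interval is controlled by `u'` and the
mass of `u` outside (`IsWeakDeriv.norm_sq_le`).

The convergence requires no compactness. Let `u`, `w` solve the equations with potentials `V`, `V_ε`
and the same right-hand side `f`, and let `χ` be a cutoff equal to `1` on a large interval. Since
`V_ε - V` is bounded on the support of `χ`, the function `χ² (u - w)` belongs to both form domains.
Testing both equations with it bounds the energy of `χ (u - w)` by a multiple of
`(sup |χ'|)² + sup_{supp χ} |V_ε - V|` (`exists_cutoff_energy_le`). Where `χ ≠ 1` both potentials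
exceed a large constant `M`, so the energy bounds for `u` and `w` show that these functions have
squared norm at most `C ‖f‖² / M` there. Altogether `‖u - w‖² ≤ η ‖f‖²` with `η` as small as desired
(`norm_sub_sq_le`), uniformly in `f`.
-/

namespace Schrodinger1D

variable {𝕜 : Type*} [RCLike 𝕜]

/-! ### A Poincaré inequality for weak derivatives -/

theorem locallyIntegrable_L2 (u : L2 𝕜) : LocallyIntegrable (u : ℝ → 𝕜) :=
  (Lp.memLp u).locallyIntegrable (by norm_num)

theorem norm_sq_eq_integral (u : L2 𝕜) : ‖u‖ ^ 2 = ∫ x, ‖u x‖ ^ 2 := by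
  have h : ((‖u‖ ^ 2 : ℝ) : 𝕜) = ((∫ x, ‖u x‖ ^ 2 : ℝ) : 𝕜) := by
    rw [← integral_ofReal]
    push_cast
    rw [← inner_self_eq_norm_sq_to_K (𝕜 := 𝕜), L2.inner_def]
    simp_rw [inner_self_eq_norm_sq_to_K]
  exact_mod_cast h

theorem integrable_norm_sq (u : L2 𝕜) : Integrable (fun x => ‖u x‖ ^ 2) :=
  (memLp_two_iff_integrable_sq_norm (Lp.aestronglyMeasurable u)).1 (Lp.memLp u)

theorem hasCompactSupport_mean {φ : ℝ → ℝ} (hc : HasCompactSupport φ) (h : ℝ) :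
    HasCompactSupport (fun x => ∫ s in (0 : ℝ)..h, φ (x - s)) := by
  refine HasCompactSupport.of_support_subset_isCompact
    (K := (fun p : ℝ × ℝ => p.1 + p.2) '' (tsupport φ ×ˢ uIcc 0 h))
    ((hc.prod isCompact_uIcc).image (by fun_prop)) ?_
  intro x hx
  by_contra hn
  refine hx ?_
  have : EqOn (fun s => φ (x - s)) (fun _ => 0) (uIcc 0 h) := by
    intro s hs
    by_contra h0
    exact hn ⟨(x - s, s), ⟨subset_tsupport φ h0, hs⟩, by simp⟩
  show ∫ s in (0 : ℝ)..h, φ (x - s) = 0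
  rw [intervalIntegral.integral_congr this]
  simp

/-- If `φ` is a test function, so is `x ↦ ∫ s in 0..h, φ (x - s)`, and its derivative is the
difference of `φ` and its translate. Used as a test function, it turns the weak derivative into
information on the translates of a function. -/
theorem hasDerivAt_mean {φ : ℝ → ℝ} (hφ : Continuous φ) (h x : ℝ) :
    HasDerivAt (fun x => ∫ s in (0 : ℝ)..h, φ (x - s)) (φ x - φ (x - h)) x := by
  have hP : ∀ y, HasDerivAt (fun y => ∫ t in (0 : ℝ)..y, φ t) (φ y) y := fun y =>
    intervalIntegral.integral_hasDerivAt_right (hφ.intervalIntegrable _ _)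
      (hφ.stronglyMeasurableAtFilter _ _) hφ.continuousAt
  have e : (fun x => ∫ s in (0 : ℝ)..h, φ (x - s)) =
      fun x => (∫ t in (0 : ℝ)..x, φ t) - ∫ t in (0 : ℝ)..(x - h), φ t := by
    funext x
    rw [intervalIntegral.integral_comp_sub_left, sub_zero, eq_sub_iff_add_eq, add_comm]
    exact intervalIntegral.integral_add_adjacent_intervals (hφ.intervalIntegrable _ _)
      (hφ.intervalIntegrable _ _)
  rw [e]
  exact (hP x).sub ((hP (x - h)).comp_sub_const x h)

theorem contDiff_mean {φ : ℝ → ℝ} (hφ : ContDiff ℝ ∞ φ) (h : ℝ) :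
    ContDiff ℝ ∞ (fun x => ∫ s in (0 : ℝ)..h, φ (x - s)) := by
  refine contDiff_infty_iff_deriv.2
    ⟨fun x => (hasDerivAt_mean hφ.continuous h x).differentiableAt, ?_⟩
  rw [show deriv (fun x => ∫ s in (0 : ℝ)..h, φ (x - s)) = fun x => φ x - φ (x - h) from
    funext fun x => (hasDerivAt_mean hφ.continuous h x).deriv]
  exact hφ.sub (hφ.comp (contDiff_id.sub contDiff_const))

/-- The integrability needed to interchange averaging over translates and pairing with a test
function. -/
theorem integrable_prod_test {φ : ℝ → ℝ} (hφ : Continuous φ) (hc : HasCompactSupport φ)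
    (g : L2 𝕜) (h : ℝ) :
    Integrable (fun p : ℝ × ℝ => φ (p.2 - p.1) • g p.2)
      ((volume.restrict (Ioc 0 h)).prod volume) := by
  set K : Set ℝ := (fun p : ℝ × ℝ => p.1 + p.2) '' (tsupport φ ×ˢ Icc 0 h) with hKdef
  have hK : IsCompact K := (hc.isCompact.prod isCompact_Icc).image (by fun_prop)
  have h1 : Integrable (K.indicator (g : ℝ → 𝕜)) :=
    (integrable_indicator_iff hK.measurableSet).2
      ((locallyIntegrable_L2 g).integrableOn_isCompact hK)
  have h2 : Integrable (fun p : ℝ × ℝ => K.indicator (g : ℝ → 𝕜) p.2)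
      ((volume.restrict (Ioc 0 h)).prod volume) := h1.comp_snd _
  obtain ⟨B, hB⟩ := hc.exists_bound_of_continuous hφ
  have h3 : Integrable (fun p : ℝ × ℝ => φ (p.2 - p.1) • K.indicator (g : ℝ → 𝕜) p.2)
      ((volume.restrict (Ioc 0 h)).prod volume) :=
    h2.bdd_smul B (by fun_prop) (Eventually.of_forall fun p => hB _)
  refine h3.congr ?_
  have h4 : ∀ᵐ p : ℝ × ℝ ∂((volume.restrict (Ioc 0 h)).prod volume), p.1 ∈ Ioc 0 h :=
    Measure.quasiMeasurePreserving_fst.ae (ae_restrict_mem measurableSet_Ioc)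
  filter_upwards [h4] with p hp
  by_cases hpK : p.2 ∈ K
  · rw [indicator_of_mem hpK]
  · have : φ (p.2 - p.1) = 0 := by
      by_contra h0
      exact hpK ⟨(p.2 - p.1, p.1), ⟨subset_tsupport φ h0, Ioc_subset_Icc_self hp⟩, by simp⟩
    rw [this, zero_smul, zero_smul]

/-- The fundamental theorem of calculus for weak derivatives: `u (x + h) - u x` is the integral of
`g` over `(x, x + h]`. Both sides have the same integral against every test function, by Fubini's
theorem. -/
theorem IsWeakDeriv.ae_translate_sub {u g : L2 𝕜} (hu : IsWeakDeriv u g) {h : ℝ} (hh : 0 ≤ h) :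
    ∀ᵐ x, u (x + h) - u x = ∫ s in Ioc 0 h, g (s + x) := by
  have hLu := locallyIntegrable_L2 u
  have hshift : LocallyIntegrable (fun x => u (x + h)) := by
    have := ((Lp.memLp u).comp_measurePreserving (measurePreserving_add_right volume h))
    exact this.locallyIntegrable (by norm_num)
  have hgi : ∀ a b : ℝ, IntervalIntegrable g volume a b := fun a b =>
    ((locallyIntegrable_L2 g).integrableOn_isCompact isCompact_uIcc).intervalIntegrable
  have hcont : Continuous fun x => ∫ s in Ioc 0 h, g (s + x) := by
    have hP := intervalIntegral.continuous_primitive hgi 0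
    have e : (fun x => ∫ s in Ioc 0 h, g (s + x)) =
        fun x => (∫ t in (0 : ℝ)..(h + x), g t) - ∫ t in (0 : ℝ)..x, g t := by
      funext x
      rw [← intervalIntegral.integral_of_le hh, intervalIntegral.integral_comp_add_right, zero_add,
        eq_sub_iff_add_eq, add_comm]
      exact intervalIntegral.integral_add_adjacent_intervals (hgi _ _) (hgi _ _)
    rw [e]
    exact (hP.comp (by fun_prop)).sub hP
  refine ae_eq_of_integral_contDiff_smul_eq (hshift.sub hLu) hcont.locallyIntegrable ?_
  intro φ hφ hc
  have hφc := hφ.continuous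
  -- the test function whose derivative is `φ - φ (· - h)`
  have hw := hu _ (contDiff_mean hφ h) (hasCompactSupport_mean hc h)
  rw [show deriv (fun x => ∫ s in (0 : ℝ)..h, φ (x - s)) = fun x => φ x - φ (x - h) from
    funext fun x => (hasDerivAt_mean hφc h x).deriv] at hw
  have i1 : Integrable fun x => φ x • u x := integrable_smul_test φ hφc hc u
  have i2 : Integrable fun x => φ x • u (x + h) :=
    hshift.integrable_smul_left_of_hasCompactSupport hφc hc
  have i3 : Integrable fun x => φ (x - h) • u x := by
    simpa using i2.comp_sub_right h
  have e2 : ∫ x, φ x • u (x + h) = ∫ x, φ (x - h) • u x := by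
    rw [← integral_sub_right_eq_self _ h]
    simp
  have eL : ∫ x, φ x • (u (x + h) - u x) = ∫ x, (∫ s in (0 : ℝ)..h, φ (x - s)) • g x := by
    simp_rw [smul_sub]
    rw [integral_sub i2 i1, e2, ← integral_sub i3 i1, ← neg_inj, ← hw, ← integral_neg]
    refine integral_congr_ae (Eventually.of_forall fun x => ?_)
    simp only [sub_smul, neg_sub]
  have hI := integrable_prod_test hφc hc g h
  have hmp : MeasurePreserving (fun z : ℝ × ℝ => (z.1, z.1 + z.2))
      ((volume.restrict (Ioc 0 h)).prod volume) ((volume.restrict (Ioc 0 h)).prod volume) :=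
    measurePreserving_prod_add _ _
  have hI' : Integrable (fun p : ℝ × ℝ => φ p.2 • g (p.1 + p.2))
      ((volume.restrict (Ioc 0 h)).prod volume) := by
    have := (hmp.integrable_comp hI.aestronglyMeasurable).2 hI
    simpa [Function.comp_def] using this
  have e3 : ∫ x, (∫ s in (0 : ℝ)..h, φ (x - s)) • g x =
      ∫ x, ∫ s in Ioc 0 h, φ (x - s) • g x := by
    refine integral_congr_ae (Eventually.of_forall fun x => ?_)
    simp only [intervalIntegral.integral_of_le hh]
    rw [integral_smul_const]
  have e4 : ∫ x, φ x • ∫ s in Ioc 0 h, g (s + x) =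
      ∫ x, ∫ s in Ioc 0 h, φ x • g (s + x) := by
    refine integral_congr_ae (Eventually.of_forall fun x => ?_)
    simp only [integral_smul]
  show ∫ x, φ x • (u (x + h) - u x) = _
  rw [eL, e3, e4, ← integral_integral_swap (f := fun s x => φ (x - s) • g x) hI,
    ← integral_integral_swap (f := fun s x => φ x • g (s + x)) hI']
  refine integral_congr_ae (Eventually.of_forall fun s => ?_)
  show ∫ x, φ (x - s) • g x = ∫ x, φ x • g (s + x)
  rw [← integral_sub_right_eq_self (fun x => φ x • g (s + x)) s]
  simp

theorem norm_integral_translate_sq_le (g : L2 𝕜) {h : ℝ} (hh : 0 ≤ h) (x : ℝ) :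
    ‖∫ s in Ioc 0 h, g (s + x)‖ ^ 2 ≤ h * ‖g‖ ^ 2 := by
  have hmem : MemLp (fun s => g (s + x)) 2 volume :=
    (Lp.memLp g).comp_measurePreserving (measurePreserving_add_right volume x)
  have hmem' : MemLp (fun s => ‖g (s + x)‖) (ENNReal.ofReal 2) (volume.restrict (Ioc 0 h)) := by
    simpa using (hmem.restrict (Ioc 0 h)).norm
  have hone : MemLp (fun _ : ℝ => (1 : ℝ)) (ENNReal.ofReal 2) (volume.restrict (Ioc 0 h)) :=
    memLp_const 1
  have hsq : ∫ s, ‖g (s + x)‖ ^ 2 = ‖g‖ ^ 2 := by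
    rw [norm_sq_eq_integral, integral_add_right_eq_self (fun s => ‖g s‖ ^ 2) x]
  have hint : Integrable fun s => ‖g (s + x)‖ ^ 2 := (integrable_norm_sq g).comp_add_right x
  have hH := integral_mul_le_Lp_mul_Lq_of_nonneg (μ := volume.restrict (Ioc 0 h))
    Real.HolderConjugate.two_two (f := fun _ => (1 : ℝ)) (g := fun s => ‖g (s + x)‖)
    (Eventually.of_forall fun _ => zero_le_one) (Eventually.of_forall fun _ => norm_nonneg _)
    hone hmem'
  simp only [one_mul, integral_const, smul_eq_mul, Real.rpow_two, one_pow, mul_one] at hH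
  have hvol : (volume.restrict (Ioc 0 h)).real univ = h := by
    simp [measureReal_def, hh]
  rw [hvol, ← Real.sqrt_eq_rpow, ← Real.sqrt_eq_rpow, ← Real.sqrt_mul hh] at hH
  have hle : ∫ s in Ioc 0 h, ‖g (s + x)‖ ^ 2 ≤ ‖g‖ ^ 2 := by
    rw [← hsq]
    exact setIntegral_le_integral hint (Eventually.of_forall fun _ => by positivity)
  have h1 := (norm_integral_le_integral_norm _).trans hH
  calc ‖∫ s in Ioc 0 h, g (s + x)‖ ^ 2
      ≤ √(h * ∫ s in Ioc 0 h, ‖g (s + x)‖ ^ 2) ^ 2 := by gcongr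
    _ = h * ∫ s in Ioc 0 h, ‖g (s + x)‖ ^ 2 := Real.sq_sqrt (by positivity)
    _ ≤ h * ‖g‖ ^ 2 := by gcongr

/-- A Poincaré inequality: the mass of `u` in `[-R, R]` is controlled by its mass outside and by its
weak derivative, since translating by `2R` moves `[-R, R]` to the outside. -/
theorem IsWeakDeriv.norm_sq_le {u g : L2 𝕜} (hu : IsWeakDeriv u g) {R : ℝ} (hR : 0 ≤ R) :
    ‖u‖ ^ 2 ≤ 3 * (∫ x in (Ico (-R) R)ᶜ, ‖u x‖ ^ 2) + 8 * R ^ 2 * ‖g‖ ^ 2 := by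
  have hi := integrable_norm_sq u
  have hsplit : ‖u‖ ^ 2 = (∫ x in Ico (-R) R, ‖u x‖ ^ 2) + ∫ x in (Ico (-R) R)ᶜ, ‖u x‖ ^ 2 := by
    rw [norm_sq_eq_integral, integral_add_compl measurableSet_Ico hi]
  have hae : ∀ᵐ x, ‖u x‖ ^ 2 ≤ 2 * ‖u (x + 2 * R)‖ ^ 2 + 2 * (2 * R * ‖g‖ ^ 2) := by
    filter_upwards [hu.ae_translate_sub (h := 2 * R) (by positivity)] with x hx
    have h1 := norm_integral_translate_sq_le g (h := 2 * R) (by positivity) x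
    rw [← hx] at h1
    have h2 : ‖u x‖ ≤ ‖u (x + 2 * R)‖ + ‖u (x + 2 * R) - u x‖ := by
      have := norm_sub_norm_le (u x) (u (x + 2 * R))
      rw [norm_sub_rev] at this
      linarith
    have h3 : ‖u x‖ ^ 2 ≤ (‖u (x + 2 * R)‖ + ‖u (x + 2 * R) - u x‖) ^ 2 := by gcongr
    have h4 := two_mul_le_add_sq ‖u (x + 2 * R)‖ ‖u (x + 2 * R) - u x‖
    nlinarith
  have hi' : Integrable fun x => ‖u (x + 2 * R)‖ ^ 2 := hi.comp_add_right (2 * R)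
  have hk : IntegrableOn (fun _ : ℝ => 2 * (2 * R * ‖g‖ ^ 2)) (Ico (-R) R) :=
    integrableOn_const (by simp)
  have hin : ∫ x in Ico (-R) R, ‖u x‖ ^ 2 ≤
      ∫ x in Ico (-R) R, (2 * ‖u (x + 2 * R)‖ ^ 2 + 2 * (2 * R * ‖g‖ ^ 2)) :=
    integral_mono_ae hi.integrableOn
      ((hi'.integrableOn.const_mul 2).add hk) (ae_restrict_of_ae hae)
  have hshift : ∫ x in Ico (-R) R, ‖u (x + 2 * R)‖ ^ 2 = ∫ x in Ico R (3 * R), ‖u x‖ ^ 2 := by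
    have := (measurePreserving_add_right volume (2 * R)).setIntegral_preimage_emb
      (measurableEmbedding_addRight _) (fun x => ‖u x‖ ^ 2) (Ico R (3 * R))
    rw [← this]
    congr 2
    ext x
    simp only [mem_Ico, mem_preimage]
    constructor <;> rintro ⟨h1, h2⟩ <;> constructor <;> linarith
  have hsub : ∫ x in Ico R (3 * R), ‖u x‖ ^ 2 ≤ ∫ x in (Ico (-R) R)ᶜ, ‖u x‖ ^ 2 :=
    setIntegral_mono_set hi.integrableOn (Eventually.of_forall fun _ => by positivity)
      (Eventually.of_forall fun x hx h => absurd h.2 (not_lt.2 hx.1))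
  rw [integral_add (hi'.integrableOn.const_mul 2) hk, integral_const_mul, hshift] at hin
  have hvol : ∫ x in Ico (-R) R, 2 * (2 * R * ‖g‖ ^ 2) = 8 * R ^ 2 * ‖g‖ ^ 2 := by
    rw [setIntegral_const, smul_eq_mul, measureReal_def, Real.volume_Ico,
      ENNReal.toReal_ofReal (by linarith)]
    ring
  linarith

/-! ### Inverse operators from coercive forms -/

/-- Multiplication by `√V`, from the form domain to `L²(ℝ)`. -/
noncomputable def sqrtMul (V : ℝ → ℝ≥0) : formDomain 𝕜 V →ₗ[𝕜] L2 𝕜 where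
  toFun u := MemLp.toLp _ u.2
  map_add' u v := by
    refine Lp.ext ?_
    filter_upwards [MemLp.coeFn_toLp (u + v).2, MemLp.coeFn_toLp u.2, MemLp.coeFn_toLp v.2,
      Lp.coeFn_add (MemLp.toLp _ u.2) (MemLp.toLp _ v.2),
      Lp.coeFn_add ((u : H1 𝕜) : L2 𝕜) ((v : H1 𝕜) : L2 𝕜)] with x h1 h2 h3 h4 h5
    rw [h1, h4, Pi.add_apply, h2, h3, Submodule.coe_add, Submodule.coe_add, h5, Pi.add_apply,
      smul_add]
  map_smul' c u := by
    refine Lp.ext ?_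
    rw [RingHom.id_apply]
    filter_upwards [MemLp.coeFn_toLp (c • u).2, MemLp.coeFn_toLp u.2,
      Lp.coeFn_smul c (MemLp.toLp _ u.2),
      Lp.coeFn_smul c ((u : H1 𝕜) : L2 𝕜)] with x h1 h2 h3 h4
    rw [h1, h3, Pi.smul_apply, h2, Submodule.coe_smul, Submodule.coe_smul, h4, Pi.smul_apply,
      smul_comm]

theorem coeFn_sqrtMul (V : ℝ → ℝ≥0) (u : formDomain 𝕜 V) :
    ∀ᵐ x, sqrtMul V u x = √(V x : ℝ) • ((u : H1 𝕜) : L2 𝕜) x :=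
  MemLp.coeFn_toLp u.2

/-- The map `u ↦ (u', √V u)`, whose squared norm is the quadratic form of `-d²/dx² + V`. -/
noncomputable def energyMap (V : ℝ → ℝ≥0) : formDomain 𝕜 V →ₗ[𝕜] WithLp 2 (L2 𝕜 × L2 𝕜) :=
  (WithLp.linearEquiv 2 𝕜 (L2 𝕜 × L2 𝕜)).symm.toLinearMap ∘ₗ
    ((weakDeriv ∘ₗ (formDomain 𝕜 V).subtype).prod (sqrtMul V))

theorem energyMap_fst (V : ℝ → ℝ≥0) (u : formDomain 𝕜 V) :
    (energyMap V u).fst = weakDeriv u.1 := rfl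

theorem energyMap_snd (V : ℝ → ℝ≥0) (u : formDomain 𝕜 V) :
    (energyMap V u).snd = sqrtMul V u := rfl

theorem form_eq_inner (V : ℝ → ℝ≥0) (v u : formDomain 𝕜 V) :
    form V v u = ⟪energyMap V v, energyMap V u⟫_𝕜 := by
  rw [WithLp.prod_inner_apply]
  show _ = ⟪weakDeriv v.1, weakDeriv u.1⟫_𝕜 + ⟪sqrtMul V v, sqrtMul V u⟫_𝕜
  rw [form, L2.inner_def (sqrtMul V v)]
  congr 1
  refine integral_congr_ae ?_
  filter_upwards [coeFn_sqrtMul V v, coeFn_sqrtMul V u] with x h1 h2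
  have hs : ((V x : ℝ) : 𝕜) = ((√(V x : ℝ) : ℝ) : 𝕜) * ((√(V x : ℝ) : ℝ) : 𝕜) := by
    rw [← RCLike.ofReal_mul, Real.mul_self_sqrt (V x).coe_nonneg]
  rw [h1, h2, hs, RCLike.real_smul_eq_coe_smul (K := 𝕜), RCLike.real_smul_eq_coe_smul (K := 𝕜),
    inner_smul_left, inner_smul_right, RCLike.conj_ofReal, mul_assoc]

theorem norm_energyMap_sq (V : ℝ → ℝ≥0) (u : formDomain 𝕜 V) :
    ‖energyMap V u‖ ^ 2 = ‖weakDeriv u.1‖ ^ 2 + ‖sqrtMul V u‖ ^ 2 := by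
  rw [WithLp.prod_norm_sq_eq_of_L2, energyMap_fst, energyMap_snd]

theorem norm_sqrtMul_sq (V : ℝ → ℝ≥0) (u : formDomain 𝕜 V) :
    ‖sqrtMul V u‖ ^ 2 = ∫ x, (V x : ℝ) * ‖((u : H1 𝕜) : L2 𝕜) x‖ ^ 2 := by
  rw [norm_sq_eq_integral]
  refine integral_congr_ae ?_
  filter_upwards [coeFn_sqrtMul V u] with x hx
  rw [hx, norm_smul, mul_pow, Real.norm_of_nonneg (Real.sqrt_nonneg _),
    Real.sq_sqrt (V x).coe_nonneg]

theorem integrable_potential_sq (V : ℝ → ℝ≥0) (u : formDomain 𝕜 V) :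
    Integrable fun x => (V x : ℝ) * ‖((u : H1 𝕜) : L2 𝕜) x‖ ^ 2 := by
  refine (integrable_norm_sq (sqrtMul V u)).congr ?_
  filter_upwards [coeFn_sqrtMul V u] with x hx
  rw [hx, norm_smul, mul_pow, Real.norm_of_nonneg (Real.sqrt_nonneg _),
    Real.sq_sqrt (V x).coe_nonneg]

theorem tendsto_integral_smul_test {φ : ℝ → ℝ} (hφ : Continuous φ) (hc : HasCompactSupport φ)
    {u : ℕ → L2 𝕜} {u₀ : L2 𝕜} (h : Tendsto u atTop (𝓝 u₀)) :
    Tendsto (fun n => ∫ x, φ x • u n x) atTop (𝓝 (∫ x, φ x • u₀ x)) := by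
  have hm : MemLp (fun x => (φ x : 𝕜)) 2 volume :=
    (RCLike.continuous_ofReal.comp hφ).memLp_of_hasCompactSupport
      (hc.comp_left (g := fun r : ℝ => (r : 𝕜)) (by simp))
  have e : ∀ w : L2 𝕜, ∫ x, φ x • w x = ⟪hm.toLp, w⟫_𝕜 := by
    intro w
    rw [L2.inner_def]
    refine integral_congr_ae ?_
    filter_upwards [hm.coeFn_toLp] with x hx
    rw [hx, RCLike.inner_apply, RCLike.conj_ofReal, RCLike.real_smul_eq_coe_mul, mul_comm]
  simp_rw [e]
  exact tendsto_const_nhds.inner h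

theorem IsWeakDeriv.of_tendsto {u g : ℕ → L2 𝕜} {u₀ g₀ : L2 𝕜}
    (hw : ∀ n, IsWeakDeriv (u n) (g n)) (hu : Tendsto u atTop (𝓝 u₀))
    (hg : Tendsto g atTop (𝓝 g₀)) : IsWeakDeriv u₀ g₀ := by
  intro φ hφ hc
  have hd : Continuous (deriv φ) := hφ.continuous_deriv (by simp)
  refine tendsto_nhds_unique (tendsto_integral_smul_test hd hc.deriv hu) ?_
  simp_rw [fun n => hw n φ hφ hc]
  exact (tendsto_integral_smul_test hφ.continuous hc hg).neg

/-- The quadratic form is closed. The limit in the second component is identified along an almost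
everywhere convergent subsequence, so that no measurability of `V` is needed. -/
theorem exists_energyMap_eq_of_tendsto (V : ℝ → ℝ≥0) {u : ℕ → formDomain 𝕜 V} {u₀ : L2 𝕜}
    {y : WithLp 2 (L2 𝕜 × L2 𝕜)}
    (hu : Tendsto (fun n => ((u n : H1 𝕜) : L2 𝕜)) atTop (𝓝 u₀))
    (hy : Tendsto (fun n => energyMap V (u n)) atTop (𝓝 y)) :
    ∃ w : formDomain 𝕜 V, energyMap V w = y := by
  have h1 : Tendsto (fun n => weakDeriv (u n).1) atTop (𝓝 y.fst) :=
    ((WithLp.prod_continuous_ofLp 2 (L2 𝕜) (L2 𝕜)).fst.tendsto y).comp hy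
  have h2 : Tendsto (fun n => sqrtMul V (u n)) atTop (𝓝 y.snd) :=
    ((WithLp.prod_continuous_ofLp 2 (L2 𝕜) (L2 𝕜)).snd.tendsto y).comp hy
  have hw : IsWeakDeriv u₀ y.fst :=
    IsWeakDeriv.of_tendsto (fun n => isWeakDeriv_weakDeriv (u n).1) hu h1
  obtain ⟨ns, hns, hae⟩ := (tendstoInMeasure_of_tendsto_Lp hu).exists_seq_tendsto_ae
  obtain ⟨ms, hms, hae'⟩ :=
    (tendstoInMeasure_of_tendsto_Lp (h2.comp hns.tendsto_atTop)).exists_seq_tendsto_ae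
  have hlim : ∀ᵐ x, y.snd x = √(V x : ℝ) • u₀ x := by
    have hall : ∀ᵐ x, ∀ n, sqrtMul V (u n) x = √(V x : ℝ) • ((u n : H1 𝕜) : L2 𝕜) x :=
      ae_all_iff.2 fun n => coeFn_sqrtMul V (u n)
    filter_upwards [hae, hae', hall] with x hx hx' hxn
    refine tendsto_nhds_unique hx' ?_
    simp only [Function.comp_apply, hxn]
    exact (hx.comp hms.tendsto_atTop).const_smul _
  refine ⟨⟨⟨u₀, y.fst, hw⟩, (memLp_congr_ae hlim).1 (Lp.memLp y.snd)⟩, ?_⟩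
  refine (WithLp.ofLp_injective 2) (Prod.ext ?_ ?_)
  · exact IsWeakDeriv.unique (isWeakDeriv_weakDeriv _) hw
  · refine Lp.ext ?_
    filter_upwards [coeFn_sqrtMul V
      ⟨⟨u₀, y.fst, hw⟩, (memLp_congr_ae hlim).1 (Lp.memLp y.snd)⟩, hlim] with x h1 h2
    exact h1.trans h2.symm

/-- `u` solves `(-d²/dx² + V) u = f` in the weak sense. -/
def IsFormSolution (V : ℝ → ℝ≥0) (u : formDomain 𝕜 V) (f : L2 𝕜) : Prop :=
  ∀ v : formDomain 𝕜 V, form V v u = ⟪((v : H1 𝕜) : L2 𝕜), f⟫_𝕜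

/-- The form of `-d²/dx² + V` is bounded below by `1 / C`, for a constant `C > 0`. -/
def IsCoerciveForm (𝕜 : Type*) [RCLike 𝕜] (V : ℝ → ℝ≥0) (C : ℝ) : Prop :=
  ∀ u : formDomain 𝕜 V, ‖((u : H1 𝕜) : L2 𝕜)‖ ^ 2 ≤ C * ‖energyMap V u‖ ^ 2

theorem IsCoerciveForm.norm_le {V : ℝ → ℝ≥0} {C : ℝ} (hV : IsCoerciveForm 𝕜 V C) (hC : 0 ≤ C)
    (u : formDomain 𝕜 V) : ‖((u : H1 𝕜) : L2 𝕜)‖ ≤ √C * ‖energyMap V u‖ := by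
  refine le_of_sq_le_sq ?_ (by positivity)
  rw [mul_pow, Real.sq_sqrt hC]
  exact hV u

theorem IsCoerciveForm.energyMap_injective {V : ℝ → ℝ≥0} {C : ℝ} (hV : IsCoerciveForm 𝕜 V C) :
    Function.Injective (energyMap (𝕜 := 𝕜) V) := by
  refine (injective_iff_map_eq_zero _).2 fun u hu => ?_
  have h := hV u
  rw [hu, norm_zero, zero_pow two_ne_zero, mul_zero] at h
  exact Subtype.ext (Subtype.ext (norm_eq_zero.1 (pow_eq_zero_iff two_ne_zero |>.1
    (le_antisymm h (sq_nonneg _)))))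

theorem IsCoerciveForm.isClosed_range {V : ℝ → ℝ≥0} {C : ℝ} (hV : IsCoerciveForm 𝕜 V C)
    (hC : 0 ≤ C) : IsClosed (LinearMap.range (energyMap (𝕜 := 𝕜) V) : Set (WithLp 2 (L2 𝕜 × L2 𝕜))) := by
  refine IsSeqClosed.isClosed fun x y hx hxy => ?_
  choose u hu using hx
  have hx' : Tendsto (fun n => energyMap V (u n)) atTop (𝓝 y) := by simpa only [hu] using hxy
  have hcau : CauchySeq fun n => ((u n : H1 𝕜) : L2 𝕜) := by
    have h0 := hx'.cauchySeq
    rw [Metric.cauchySeq_iff'] at h0 ⊢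
    intro ε hε
    obtain ⟨N, hN⟩ := h0 (ε / (√C + 1)) (by positivity)
    refine ⟨N, fun n hn => ?_⟩
    have h1 := hV.norm_le hC (u n - u N)
    have h2 := hN n hn
    rw [dist_eq_norm, ← map_sub] at h2
    rw [dist_eq_norm]
    rw [lt_div_iff₀ (by positivity)] at h2
    refine h1.trans_lt (lt_of_le_of_lt ?_ h2)
    nlinarith [norm_nonneg (energyMap V (u n - u N))]
  obtain ⟨u₀, hu₀⟩ := cauchySeq_tendsto_of_complete hcau
  exact exists_energyMap_eq_of_tendsto V hu₀ hx'

/-- The weak equation `(-d²/dx² + V) u = f` is solved by a bounded operator: if `S` denotes the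
inverse of `energyMap V`, defined on the range of the latter, this operator is `S S*`. -/
theorem IsCoerciveForm.exists_solution_operator {V : ℝ → ℝ≥0} {C : ℝ}
    (hV : IsCoerciveForm 𝕜 V C) (hC : 0 ≤ C) :
    ∃ T : L2 𝕜 →L[𝕜] L2 𝕜, ∀ f, ∃ u : formDomain 𝕜 V, ((u : H1 𝕜) : L2 𝕜) = T f ∧
      IsFormSolution V u f := by
  set J := energyMap (𝕜 := 𝕜) V
  have : CompleteSpace (LinearMap.range J) :=
    (hV.isClosed_range hC).isComplete.completeSpace_coe
  set E := LinearEquiv.ofInjective J hV.energyMap_injective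
  have hE : ∀ y, J (E.symm y) = (y : WithLp 2 (L2 𝕜 × L2 𝕜)) := fun y =>
    congrArg Subtype.val (E.apply_symm_apply y)
  set S₀ : LinearMap.range J →ₗ[𝕜] L2 𝕜 :=
    (H1 𝕜).subtype ∘ₗ (formDomain 𝕜 V).subtype ∘ₗ E.symm.toLinearMap
  have hS₀ : ∀ y, S₀ y = ((E.symm y : H1 𝕜) : L2 𝕜) := fun _ => rfl
  set S : LinearMap.range J →L[𝕜] L2 𝕜 := S₀.mkContinuous √C fun y => by
    rw [hS₀]
    refine (hV.norm_le hC (E.symm y)).trans_eq ?_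
    rw [hE, Submodule.coe_norm]
  refine ⟨S ∘L S.adjoint, fun f => ⟨E.symm (S.adjoint f), rfl, fun v => ?_⟩⟩
  rw [form_eq_inner, hE]
  have h := ContinuousLinearMap.adjoint_inner_right S (E v) f
  rw [Submodule.coe_inner] at h
  refine h.trans ?_
  show ⟪((E.symm (E v) : H1 𝕜) : L2 𝕜), f⟫_𝕜 = _
  rw [E.symm_apply_apply]

theorem IsFormSolution.norm_energyMap_sq_le {V : ℝ → ℝ≥0} {u : formDomain 𝕜 V} {f : L2 𝕜}
    (h : IsFormSolution V u f) : ‖energyMap V u‖ ^ 2 ≤ ‖((u : H1 𝕜) : L2 𝕜)‖ * ‖f‖ := by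
  have h1 := h u
  rw [form_eq_inner] at h1
  rw [← inner_self_eq_norm_sq (𝕜 := 𝕜), h1]
  exact re_inner_le_norm _ _

theorem IsCoerciveForm.norm_solution_le {V : ℝ → ℝ≥0} {C : ℝ} (hV : IsCoerciveForm 𝕜 V C)
    (hC : 0 ≤ C) {u : formDomain 𝕜 V} {f : L2 𝕜} (h : IsFormSolution V u f) :
    ‖((u : H1 𝕜) : L2 𝕜)‖ ≤ C * ‖f‖ := by
  have h1 := (hV u).trans (mul_le_mul_of_nonneg_left h.norm_energyMap_sq_le hC)
  rcases (norm_nonneg ((u : H1 𝕜) : L2 𝕜)).eq_or_lt with h0 | h0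
  · rw [← h0]
    positivity
  · nlinarith

theorem IsCoerciveForm.solution_unique {V : ℝ → ℝ≥0} {C : ℝ} (hV : IsCoerciveForm 𝕜 V C)
    {u w : formDomain 𝕜 V} {f : L2 𝕜} (hu : IsFormSolution V u f) (hw : IsFormSolution V w f) :
    u = w := by
  refine hV.energyMap_injective (sub_eq_zero.1 ?_)
  have h := (hu (u - w)).trans (hw (u - w)).symm
  rw [form_eq_inner, form_eq_inner, ← sub_eq_zero, ← inner_sub_right, map_sub] at h
  exact inner_self_eq_zero.1 h

/-- The solution operator of a coercive form is the bounded inverse of the Schrödinger operator. For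
`f` orthogonal to the operator domain, `T f` is itself in that domain, so its energy `⟪T f, f⟫`
vanishes; the density of the operator domain in the form domain is therefore not needed. -/
theorem isBoundedInverse_of_solution_operator {V : ℝ → ℝ≥0} {C : ℝ} (hV : IsCoerciveForm 𝕜 V C)
    {T : L2 𝕜 →L[𝕜] L2 𝕜} (hT : ∀ f, ∃ u : formDomain 𝕜 V, ((u : H1 𝕜) : L2 𝕜) = T f ∧
      IsFormSolution V u f) : IsBoundedInverse (schrodingerOp 𝕜 V) T := by
  have hdom : ∀ f ∈ (formDomainL2 𝕜 V).topologicalClosure,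
      ((T f, f) : L2 𝕜 × L2 𝕜) ∈ (schrodingerOp 𝕜 V).graph := by
    intro f hf
    rw [schrodingerOp_graph]
    obtain ⟨u, hu, h⟩ := hT f
    exact ⟨hf, u, hu, h⟩
  have hsub : (schrodingerOp 𝕜 V).domain ≤ formDomainL2 𝕜 V := by
    intro u hu
    have := (schrodingerOp 𝕜 V).mem_graph ⟨u, hu⟩
    rw [schrodingerOp_graph] at this
    obtain ⟨_, w, hw, _⟩ := this
    exact ⟨w.1, w.2, hw⟩
  refine ⟨fun u => ?_, fun f hf => ?_, fun f hf => ?_⟩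
  · have := (schrodingerOp 𝕜 V).mem_graph u
    rw [schrodingerOp_graph] at this
    obtain ⟨_, w, hw, h⟩ := this
    obtain ⟨w', hw', h'⟩ := hT (schrodingerOp 𝕜 V u)
    exact hw'.symm.trans ((congrArg (fun z : formDomain 𝕜 V => ((z : H1 𝕜) : L2 𝕜))
      (hV.solution_unique h' h)).trans hw)
  · obtain ⟨x, hx, hx'⟩ := (LinearPMap.mem_graph_iff _).1
      (hdom f (Submodule.topologicalClosure_mono hsub hf))
    simp only at hx hx'
    exact ⟨hx ▸ x.2, (congrArg _ (Subtype.ext hx.symm)).trans hx'⟩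
  · obtain ⟨u, hu, h⟩ := hT f
    set p := (formDomainL2 𝕜 V).topologicalClosure.starProjection f
    -- the weak equation only sees the component of `f` in the closure of the form domain
    have hp : ((u : H1 𝕜) : L2 𝕜) ∈ (schrodingerOp 𝕜 V).domain := by
      refine LinearPMap.mem_domain_of_mem_graph (y := p) ?_
      rw [schrodingerOp_graph]
      refine ⟨Submodule.starProjection_apply_mem _ f, u, rfl, fun v => ?_⟩
      rw [h v, ← sub_eq_zero, ← inner_sub_right]
      exact (Submodule.mem_orthogonal _ _).1 (Submodule.sub_starProjection_mem_orthogonal f) _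
        (Submodule.le_topologicalClosure _ ⟨v.1, v.2, rfl⟩)
    have h0 := h u
    rw [(Submodule.mem_orthogonal _ _).1 hf _ hp, form_eq_inner] at h0
    rw [← hu, (injective_iff_map_eq_zero _).1 hV.energyMap_injective u (inner_self_eq_zero.1 h0)]
    rfl

/-! ### Localization of the difference of two solutions -/

theorem memLp_smul_test {χ : ℝ → ℝ} (hχ : Continuous χ) (hc : HasCompactSupport χ) (u : L2 𝕜) :
    MemLp (fun x => χ x • u x) 2 volume := by
  obtain ⟨B, hB⟩ := hc.exists_bound_of_continuous hχ
  refine (Lp.memLp u).of_le_mul (c := B)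
    (hχ.aestronglyMeasurable.smul (Lp.aestronglyMeasurable u)) (Eventually.of_forall fun x => ?_)
  rw [norm_smul]
  gcongr
  exact hB x

/-- Multiplication by a continuous compactly supported function, on `L²(ℝ)`. -/
noncomputable def testMul {χ : ℝ → ℝ} (hχ : Continuous χ) (hc : HasCompactSupport χ) :
    L2 𝕜 →ₗ[𝕜] L2 𝕜 where
  toFun u := (memLp_smul_test hχ hc u).toLp
  map_add' u v := by
    refine Lp.ext ?_
    filter_upwards [(memLp_smul_test hχ hc (u + v)).coeFn_toLp, (memLp_smul_test hχ hc u).coeFn_toLp,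
      (memLp_smul_test hχ hc v).coeFn_toLp, Lp.coeFn_add u v,
      Lp.coeFn_add (memLp_smul_test hχ hc u).toLp (memLp_smul_test hχ hc v).toLp]
      with x h1 h2 h3 h4 h5
    rw [h1, h5, Pi.add_apply, h2, h3, h4, Pi.add_apply, smul_add]
  map_smul' c u := by
    refine Lp.ext ?_
    rw [RingHom.id_apply]
    filter_upwards [(memLp_smul_test hχ hc (c • u)).coeFn_toLp,
      (memLp_smul_test hχ hc u).coeFn_toLp, Lp.coeFn_smul c u,
      Lp.coeFn_smul c (memLp_smul_test hχ hc u).toLp] with x h1 h2 h3 h4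
    rw [h1, h4, Pi.smul_apply, h2, h3, Pi.smul_apply, smul_comm]

theorem coeFn_testMul {χ : ℝ → ℝ} (hχ : Continuous χ) (hc : HasCompactSupport χ) (u : L2 𝕜) :
    ∀ᵐ x, testMul hχ hc u x = χ x • u x :=
  (memLp_smul_test hχ hc u).coeFn_toLp

/-- The product rule for weak derivatives. -/
theorem IsWeakDeriv.testMul {u g : L2 𝕜} (hu : IsWeakDeriv u g) {χ : ℝ → ℝ}
    (hχ : ContDiff ℝ ∞ χ) (hc : HasCompactSupport χ) :
    IsWeakDeriv (testMul hχ.continuous hc u)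
      (Schrodinger1D.testMul (hχ.continuous_deriv (by simp)) hc.deriv u +
        Schrodinger1D.testMul hχ.continuous hc g) := by
  intro φ hφ hφc
  have hφχ : ContDiff ℝ ∞ fun x => φ x * χ x := hφ.mul hχ
  have hφd : Continuous (deriv φ) := hφ.continuous_deriv (by simp)
  have hχd : Continuous (deriv χ) := hχ.continuous_deriv (by simp)
  have h := hu _ hφχ hφc.mul_right
  have i1 : Integrable fun x => (deriv φ x * χ x) • u x :=
    integrable_smul_test _ (hφd.mul hχ.continuous) hφc.deriv.mul_right u
  have i2 : Integrable fun x => (φ x * deriv χ x) • u x :=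
    integrable_smul_test _ (hφ.continuous.mul hχd) hφc.mul_right u
  have i3 : Integrable fun x => (φ x * χ x) • g x :=
    integrable_smul_test _ hφχ.continuous hφc.mul_right g
  have e1 : ∫ x, deriv (fun x => φ x * χ x) x • u x =
      (∫ x, (deriv φ x * χ x) • u x) + ∫ x, (φ x * deriv χ x) • u x := by
    rw [← integral_add i1 i2]
    refine integral_congr_ae (Eventually.of_forall fun x => ?_)
    simp only
    rw [deriv_fun_mul (hφ.differentiable (by simp) x) (hχ.differentiable (by simp) x), add_smul]
  have e2 : ∫ x, deriv φ x • Schrodinger1D.testMul hχ.continuous hc u x =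
      ∫ x, (deriv φ x * χ x) • u x := by
    refine integral_congr_ae ?_
    filter_upwards [coeFn_testMul hχ.continuous hc u] with x hx
    rw [hx, smul_smul]
  have e3 : ∫ x, φ x • (Schrodinger1D.testMul hχd hc.deriv u +
        Schrodinger1D.testMul hχ.continuous hc g : L2 𝕜) x =
      (∫ x, (φ x * deriv χ x) • u x) + ∫ x, (φ x * χ x) • g x := by
    rw [← integral_add i2 i3]
    refine integral_congr_ae ?_
    filter_upwards [coeFn_testMul hχ.continuous hc g, coeFn_testMul hχd hc.deriv u,
      Lp.coeFn_add (Schrodinger1D.testMul hχd hc.deriv u)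
        (Schrodinger1D.testMul hχ.continuous hc g)] with x h1 h2 h3
    rw [h3, Pi.add_apply, h1, h2, smul_add, smul_smul, smul_smul]
  rw [e2, e3, neg_add]
  rw [e1] at h
  linear_combination h

/-- Compactly supported cutoffs of elements of one form domain lie in the other form domain, when
the potentials differ by a bounded amount on the support of the cutoff. -/
theorem memLp_sqrt_smul_testMul {V W : ℝ → ℝ≥0} (hV : AEMeasurable V volume) {χ : ℝ → ℝ}
    (hχ : Continuous χ) (hc : HasCompactSupport χ) (hχ1 : ∀ x, |χ x| ≤ 1) {δ : ℝ}
    (hδ : ∀ x, χ x ≠ 0 → |(W x : ℝ) - V x| ≤ δ) (a : formDomain 𝕜 W) :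
    MemLp (fun x => √(V x : ℝ) • testMul hχ hc ((a : H1 𝕜) : L2 𝕜) x) 2 volume := by
  have hdom : MemLp (fun x => ‖√(W x : ℝ) • ((a : H1 𝕜) : L2 𝕜) x‖ +
      √δ * ‖((a : H1 𝕜) : L2 𝕜) x‖) 2 volume :=
    (a.2 : MemLp _ 2 volume).norm.add ((Lp.memLp ((a : H1 𝕜) : L2 𝕜)).norm.const_mul _)
  have hVm : AEMeasurable (fun x => √(V x : ℝ)) volume := hV.coe_nnreal_real.sqrt
  refine hdom.mono (hVm.aestronglyMeasurable.smul (Lp.aestronglyMeasurable _)) ?_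
  filter_upwards [coeFn_testMul hχ hc ((a : H1 𝕜) : L2 𝕜)] with x hx
  rw [hx, Real.norm_of_nonneg (by positivity), norm_smul, norm_smul, norm_smul,
    Real.norm_of_nonneg (Real.sqrt_nonneg _), Real.norm_of_nonneg (Real.sqrt_nonneg _),
    Real.norm_eq_abs, ← add_mul, ← mul_assoc]
  gcongr
  by_cases h0 : χ x = 0
  · rw [h0, abs_zero, mul_zero]
    positivity
  · have hd := hδ x h0
    have hδ0 : 0 ≤ δ := (abs_nonneg _).trans hd
    calc √(V x : ℝ) * |χ x| ≤ √(V x : ℝ) * 1 := by gcongr; exact hχ1 x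
      _ ≤ √((W x : ℝ) + δ) := by
        rw [mul_one]
        exact Real.sqrt_le_sqrt (by linarith [(abs_le.1 hd).1])
      _ ≤ √(W x : ℝ) + √δ := by
        rw [Real.sqrt_le_left (by positivity), add_sq, Real.sq_sqrt (W x).coe_nonneg,
          Real.sq_sqrt hδ0]
        nlinarith [mul_nonneg (Real.sqrt_nonneg (W x : ℝ)) (Real.sqrt_nonneg δ)]

theorem exists_formDomain_eq_testMul_sub {V V₁ V₂ : ℝ → ℝ≥0} (hV : AEMeasurable V volume)
    {χ : ℝ → ℝ} (hχ : ContDiff ℝ ∞ χ) (hc : HasCompactSupport χ) (hχ1 : ∀ x, |χ x| ≤ 1) {δ : ℝ}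
    (hδ₁ : ∀ x, χ x ≠ 0 → |(V₁ x : ℝ) - V x| ≤ δ) (hδ₂ : ∀ x, χ x ≠ 0 → |(V₂ x : ℝ) - V x| ≤ δ)
    (u : formDomain 𝕜 V₁) (w : formDomain 𝕜 V₂) :
    ∃ z : formDomain 𝕜 V, ((z : H1 𝕜) : L2 𝕜) =
      testMul hχ.continuous hc (((u : H1 𝕜) - (w : H1 𝕜) : H1 𝕜) : L2 𝕜) := by
  have hu := (isWeakDeriv_weakDeriv u.1).testMul hχ hc
  have hw := (isWeakDeriv_weakDeriv w.1).testMul hχ hc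
  let z₁ : formDomain 𝕜 V :=
    ⟨⟨_, _, hu⟩, memLp_sqrt_smul_testMul hV hχ.continuous hc hχ1 hδ₁ u⟩
  let z₂ : formDomain 𝕜 V :=
    ⟨⟨_, _, hw⟩, memLp_sqrt_smul_testMul hV hχ.continuous hc hχ1 hδ₂ w⟩
  refine ⟨z₁ - z₂, ?_⟩
  rw [Submodule.coe_sub, Submodule.coe_sub, Submodule.coe_sub, map_sub]

theorem weakDeriv_testMul {z a : H1 𝕜} {χ : ℝ → ℝ} (hχ : ContDiff ℝ ∞ χ)
    (hc : HasCompactSupport χ) (hz : (z : L2 𝕜) = testMul hχ.continuous hc (a : L2 𝕜)) :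
    ∀ᵐ x, weakDeriv z x = deriv χ x • (a : L2 𝕜) x + χ x • weakDeriv a x := by
  have h := (isWeakDeriv_weakDeriv a).testMul hχ hc
  rw [← hz] at h
  rw [(isWeakDeriv_weakDeriv z).unique h]
  filter_upwards [Lp.coeFn_add (testMul (hχ.continuous_deriv (by simp)) hc.deriv (a : L2 𝕜))
      (testMul hχ.continuous hc (weakDeriv a)),
    coeFn_testMul (hχ.continuous_deriv (by simp)) hc.deriv (a : L2 𝕜),
    coeFn_testMul hχ.continuous hc (weakDeriv a)] with x h1 h2 h3
  rw [h1, Pi.add_apply, h2, h3]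

/-- The pointwise form of the localization identity
`re ⟪(χ² d)', d'⟫ = |(χ d)'|² - |χ'|² |d|²`, including the potential terms. Here `d = a - b` is the
value of the difference of two solutions, `g` that of its derivative, `c` and `c'` those of the
cutoff and its derivative, and `v`, `w` those of the two potentials. -/
theorem pointwise_cutoff_le {d g a b : 𝕜} (hd : d = a - b) {c c' v w κ δ : ℝ}
    (hc : |c| ≤ 1) (hc' : |c'| ≤ κ) (hvw : c ≠ 0 → |w - v| ≤ δ) (hδ : 0 ≤ δ) :
    ‖c' • d + c • g‖ ^ 2 + v * ‖c • d‖ ^ 2 ≤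
      RCLike.re ⟪(2 * c * c') • d + c ^ 2 • g, g⟫_𝕜 + RCLike.re ((v : 𝕜) * ⟪c ^ 2 • d, a⟫_𝕜) -
        RCLike.re ((w : 𝕜) * ⟪c ^ 2 • d, b⟫_𝕜) + κ ^ 2 * ‖d‖ ^ 2 + δ * (‖d‖ ^ 2 + ‖b‖ ^ 2) := by
  have hre : ∀ (r : ℝ) (x y : 𝕜), RCLike.re ⟪r • x, y⟫_𝕜 = r * RCLike.re ⟪x, y⟫_𝕜 := by
    intro r x y
    rw [RCLike.real_smul_eq_coe_smul (K := 𝕜), inner_smul_left, RCLike.conj_ofReal,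
      RCLike.re_ofReal_mul]
  have h1 : ‖c' • d + c • g‖ ^ 2 =
      c' ^ 2 * ‖d‖ ^ 2 + 2 * c * c' * RCLike.re ⟪d, g⟫_𝕜 + c ^ 2 * ‖g‖ ^ 2 := by
    rw [norm_add_sq (𝕜 := 𝕜), hre, ← RCLike.conj_re ⟪d, c • g⟫_𝕜, inner_conj_symm, hre,
      ← RCLike.conj_re ⟪g, d⟫_𝕜, inner_conj_symm, norm_smul, norm_smul, mul_pow, mul_pow,
      Real.norm_eq_abs, Real.norm_eq_abs, sq_abs, sq_abs]
    ring
  have h2 : ‖c • d‖ ^ 2 = c ^ 2 * ‖d‖ ^ 2 := by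
    rw [norm_smul, mul_pow, Real.norm_eq_abs, sq_abs]
  have h3 : RCLike.re ⟪d, a⟫_𝕜 = ‖d‖ ^ 2 + RCLike.re ⟪d, b⟫_𝕜 := by
    rw [← inner_self_eq_norm_sq (𝕜 := 𝕜), ← map_add, ← inner_add_right]
    congr 2
    rw [hd]; ring
  have h4 : |RCLike.re ⟪d, b⟫_𝕜| ≤ ‖d‖ * ‖b‖ := by
    exact (RCLike.abs_re_le_norm _).trans (norm_inner_le_norm _ _)
  have h5 : c ^ 2 ≤ 1 := by rw [← sq_abs]; exact pow_le_one₀ (abs_nonneg _) hc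
  have h6 : c' ^ 2 ≤ κ ^ 2 := by rw [← sq_abs]; gcongr
  have h7 : (w - v) * c ^ 2 * RCLike.re ⟪d, b⟫_𝕜 ≤ δ * (‖d‖ ^ 2 + ‖b‖ ^ 2) := by
    rcases eq_or_ne c 0 with h0 | h0
    · rw [h0]
      have : 0 ≤ δ * (‖d‖ ^ 2 + ‖b‖ ^ 2) := by positivity
      simpa using this
    · calc (w - v) * c ^ 2 * RCLike.re ⟪d, b⟫_𝕜 ≤ |(w - v) * c ^ 2 * RCLike.re ⟪d, b⟫_𝕜| :=
            le_abs_self _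
        _ = |w - v| * c ^ 2 * |RCLike.re ⟪d, b⟫_𝕜| := by
            rw [abs_mul, abs_mul, abs_of_nonneg (sq_nonneg c)]
        _ ≤ δ * 1 * (‖d‖ * ‖b‖) := by
            gcongr
            exact hvw h0
        _ ≤ δ * (‖d‖ ^ 2 + ‖b‖ ^ 2) := by
            rw [mul_one]
            gcongr
            nlinarith [sq_nonneg (‖d‖ - ‖b‖), sq_nonneg ‖d‖, sq_nonneg ‖b‖]
  rw [inner_add_left, map_add, hre, hre, RCLike.re_ofReal_mul, RCLike.re_ofReal_mul, hre, hre, h1,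
    h2, h3, inner_self_eq_norm_sq]
  have h8 : c' ^ 2 * ‖d‖ ^ 2 ≤ κ ^ 2 * ‖d‖ ^ 2 := by gcongr
  nlinarith

/-- The localized energy estimate for the difference of the solutions of two Schrödinger equations
with the same right-hand side. It comes from testing the difference of the equations with
`χ² (u - w)`, which belongs to both form domains. -/
theorem exists_cutoff_energy_le {V W : ℝ → ℝ≥0} (hV : AEMeasurable V volume)
    (hW : AEMeasurable W volume) {u : formDomain 𝕜 V} {w : formDomain 𝕜 W} {f : L2 𝕜}
    (hu : IsFormSolution V u f) (hw : IsFormSolution W w f) {χ : ℝ → ℝ} (hχ : ContDiff ℝ ∞ χ)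
    (hc : HasCompactSupport χ) (hχ1 : ∀ x, |χ x| ≤ 1) {κ δ : ℝ} (hκ : ∀ x, |deriv χ x| ≤ κ)
    (hδ0 : 0 ≤ δ) (hδ : ∀ x, χ x ≠ 0 → |(W x : ℝ) - V x| ≤ δ) :
    ∃ z : formDomain 𝕜 V, ((z : H1 𝕜) : L2 𝕜) =
        testMul hχ.continuous hc (((u : H1 𝕜) - (w : H1 𝕜) : H1 𝕜) : L2 𝕜) ∧
      ‖energyMap V z‖ ^ 2 ≤ κ ^ 2 * ‖(((u : H1 𝕜) - (w : H1 𝕜) : H1 𝕜) : L2 𝕜)‖ ^ 2 +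
        δ * (‖(((u : H1 𝕜) - (w : H1 𝕜) : H1 𝕜) : L2 𝕜)‖ ^ 2 + ‖((w : H1 𝕜) : L2 𝕜)‖ ^ 2) := by
  set d : H1 𝕜 := (u : H1 𝕜) - (w : H1 𝕜) with hd
  obtain ⟨z, hz⟩ := exists_formDomain_eq_testMul_sub hV hχ hc hχ1
    (fun x _ => by rw [sub_self, abs_zero]; exact hδ0) hδ u w
  refine ⟨z, hz, ?_⟩
  have hχ2 : ContDiff ℝ ∞ fun x => χ x ^ 2 := hχ.pow 2
  have hc2 : HasCompactSupport fun x => χ x ^ 2 := hc.comp_left (g := fun r : ℝ => r ^ 2) (by simp)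
  have hχ21 : ∀ x, |χ x ^ 2| ≤ 1 := fun x => by
    rw [abs_pow]
    exact pow_le_one₀ (abs_nonneg _) (hχ1 x)
  have hne : ∀ x, χ x ^ 2 ≠ 0 → χ x ≠ 0 := fun x h h0 => h (by rw [h0]; simp)
  obtain ⟨p, hp⟩ := exists_formDomain_eq_testMul_sub hV hχ2 hc2 hχ21
    (fun x _ => by rw [sub_self, abs_zero]; exact hδ0) (fun x h => hδ x (hne x h)) u w
  obtain ⟨q, hq⟩ := exists_formDomain_eq_testMul_sub hW hχ2 hc2 hχ21
    (fun x h => by rw [abs_sub_comm]; exact hδ x (hne x h))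
    (fun x _ => by rw [sub_self, abs_zero]; exact hδ0) u w
  have hpq : (p : H1 𝕜) = q := Subtype.ext (hp.trans hq.symm)
  -- the two weak equations, tested with `χ² (u - w)`
  have heq : form V p u = form W q w := by rw [hu p, hw q, hpq]
  have hzero : RCLike.re ⟪weakDeriv p.1, weakDeriv d⟫_𝕜 +
      RCLike.re (∫ x, ((V x : ℝ) : 𝕜) * ⟪((p : H1 𝕜) : L2 𝕜) x, ((u : H1 𝕜) : L2 𝕜) x⟫_𝕜) -
      RCLike.re (∫ x, ((W x : ℝ) : 𝕜) * ⟪((q : H1 𝕜) : L2 𝕜) x, ((w : H1 𝕜) : L2 𝕜) x⟫_𝕜) = 0 := by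
    rw [form, form, ← hpq] at heq
    rw [hd, map_sub, inner_sub_right, ← map_add, ← map_sub, ← hpq, sub_add_eq_add_sub, heq]
    simp
  have iA := (integrable_norm_sq (weakDeriv z.1)).fun_add (integrable_potential_sq V z)
  have i1 := (L2.integrable_inner (𝕜 := 𝕜) (weakDeriv p.1) (weakDeriv d)).re
  have i2 := (integrable_potential V p u).re
  have i3 := (integrable_potential W q w).re
  have i4 := (integrable_norm_sq (d : L2 𝕜)).const_mul (κ ^ 2)
  have i5 := ((integrable_norm_sq (d : L2 𝕜)).fun_add
    (integrable_norm_sq ((w : H1 𝕜) : L2 𝕜))).const_mul δ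
  have hA : ‖energyMap V z‖ ^ 2 = ∫ x, (‖weakDeriv z.1 x‖ ^ 2 +
      (V x : ℝ) * ‖((z : H1 𝕜) : L2 𝕜) x‖ ^ 2) := by
    rw [norm_energyMap_sq, norm_sqrtMul_sq, norm_sq_eq_integral,
      integral_add (integrable_norm_sq _) (integrable_potential_sq V z)]
  have hB : κ ^ 2 * ‖(d : L2 𝕜)‖ ^ 2 + δ * (‖(d : L2 𝕜)‖ ^ 2 + ‖((w : H1 𝕜) : L2 𝕜)‖ ^ 2) =
      ∫ x, (RCLike.re ⟪weakDeriv p.1 x, weakDeriv d x⟫_𝕜 +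
        RCLike.re (((V x : ℝ) : 𝕜) * ⟪((p : H1 𝕜) : L2 𝕜) x, ((u : H1 𝕜) : L2 𝕜) x⟫_𝕜) -
        RCLike.re (((W x : ℝ) : 𝕜) * ⟪((q : H1 𝕜) : L2 𝕜) x, ((w : H1 𝕜) : L2 𝕜) x⟫_𝕜) +
        κ ^ 2 * ‖(d : L2 𝕜) x‖ ^ 2 +
        δ * (‖(d : L2 𝕜) x‖ ^ 2 + ‖((w : H1 𝕜) : L2 𝕜) x‖ ^ 2)) := by
    rw [integral_add (((i1.fun_add i2).sub' i3).fun_add i4) i5, integral_add ((i1.fun_add i2).sub' i3) i4,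
      integral_sub (i1.fun_add i2) i3, integral_add i1 i2, integral_re (L2.integrable_inner _ _),
      integral_re (integrable_potential V p u), integral_re (integrable_potential W q w),
      ← L2.inner_def, hzero, zero_add, integral_const_mul, integral_const_mul,
      integral_add (integrable_norm_sq _) (integrable_norm_sq _), ← norm_sq_eq_integral,
      ← norm_sq_eq_integral]
  rw [hA, hB]
  refine integral_mono_ae iA ((((i1.fun_add i2).sub' i3).fun_add i4).fun_add i5) ?_
  filter_upwards [weakDeriv_testMul hχ hc hz, weakDeriv_testMul hχ2 hc2 hp,
    coeFn_testMul hχ.continuous hc (d : L2 𝕜), coeFn_testMul hχ2.continuous hc2 (d : L2 𝕜),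
    Lp.coeFn_sub ((u : H1 𝕜) : L2 𝕜) ((w : H1 𝕜) : L2 𝕜)] with x h1 h2 h3 h4 h5
  rw [Pi.sub_apply] at h5
  have hder : deriv (fun x => χ x ^ 2) x = 2 * χ x * deriv χ x := by
    rw [deriv_fun_pow (hχ.differentiable (by simp) x)]
    simp
  rw [h1, h2, hz, hp, hq, h3, h4, hder]
  exact pointwise_cutoff_le h5 (hχ1 x)
    (hκ x) (hδ x) hδ0

/-! ### Stability of the inverse -/

theorem setIntegral_norm_sq_le {V : ℝ → ℝ≥0} {s : Set ℝ} (hs : MeasurableSet s) {M : ℝ}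
    (hM : 0 < M) (hV : ∀ x ∈ s, M ≤ V x) (u : formDomain 𝕜 V) :
    ∫ x in s, ‖((u : H1 𝕜) : L2 𝕜) x‖ ^ 2 ≤ ‖sqrtMul V u‖ ^ 2 / M := by
  rw [le_div_iff₀ hM, norm_sqrtMul_sq, ← integral_mul_const]
  have hi := integrable_potential_sq V u
  refine (setIntegral_mono_on ((integrable_norm_sq _).integrableOn.mul_const M) hi.integrableOn hs
    fun x hx => ?_).trans (setIntegral_le_integral hi (Eventually.of_forall fun x => ?_))
  · rw [mul_comm]
    gcongr
    exact hV x hx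
  · show 0 ≤ (V x : ℝ) * ‖((u : H1 𝕜) : L2 𝕜) x‖ ^ 2
    positivity

theorem isCoerciveForm_of_one_le {V : ℝ → ℝ≥0} {R : ℝ} (hR : 0 ≤ R)
    (hV : ∀ x ∉ Ico (-R) R, (1 : ℝ) ≤ V x) : IsCoerciveForm 𝕜 V (3 + 8 * R ^ 2) := by
  intro u
  have h1 := (isWeakDeriv_weakDeriv u.1).norm_sq_le hR
  have h2 := setIntegral_norm_sq_le measurableSet_Ico.compl one_pos hV u
  rw [div_one] at h2
  rw [norm_energyMap_sq]
  nlinarith [mul_nonneg (sq_nonneg R) (sq_nonneg ‖sqrtMul V u‖), sq_nonneg ‖weakDeriv u.1‖]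

/-- A quantitative stability estimate: the potentials are large on `s`, and close to each other on
the support of a cutoff function `χ` which is `1` off `s`. -/
theorem norm_sub_sq_le {V W : ℝ → ℝ≥0} (hV : AEMeasurable V volume) (hW : AEMeasurable W volume)
    {C : ℝ} (hC : 0 ≤ C) (hVC : IsCoerciveForm 𝕜 V C) (hWC : IsCoerciveForm 𝕜 W C)
    {u : formDomain 𝕜 V} {w : formDomain 𝕜 W} {f : L2 𝕜}
    (hu : IsFormSolution V u f) (hw : IsFormSolution W w f) {s : Set ℝ} (hs : MeasurableSet s)
    {M : ℝ} (hM : 0 < M) (hVM : ∀ x ∈ s, M ≤ V x) (hWM : ∀ x ∈ s, M ≤ W x)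
    {χ : ℝ → ℝ} (hχ : ContDiff ℝ ∞ χ) (hc : HasCompactSupport χ) (hχ1 : ∀ x, |χ x| ≤ 1)
    (hχs : ∀ x ∉ s, χ x = 1) {κ δ : ℝ} (hκ : ∀ x, |deriv χ x| ≤ κ)
    (hδ0 : 0 ≤ δ) (hδ : ∀ x, χ x ≠ 0 → |(W x : ℝ) - V x| ≤ δ) :
    ‖((u : H1 𝕜) : L2 𝕜) - ((w : H1 𝕜) : L2 𝕜)‖ ^ 2 ≤
      (4 * C ^ 3 * κ ^ 2 + 5 * C ^ 3 * δ + 4 * C / M) * ‖f‖ ^ 2 := by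
  obtain ⟨z, hz, hzE⟩ := exists_cutoff_energy_le hV hW hu hw hχ hc hχ1 hκ hδ0 hδ
  have hzC := hVC z
  rw [hz] at hzC
  rw [Submodule.coe_sub] at hzE hzC
  set a : L2 𝕜 := ((u : H1 𝕜) : L2 𝕜)
  set b : L2 𝕜 := ((w : H1 𝕜) : L2 𝕜)
  have ha : ‖a‖ ≤ C * ‖f‖ := hVC.norm_solution_le hC hu
  have hb : ‖b‖ ≤ C * ‖f‖ := hWC.norm_solution_le hC hw
  have hab : ‖a - b‖ ≤ 2 * C * ‖f‖ := (norm_sub_le a b).trans (by linarith)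
  have hb2 : ‖b‖ ^ 2 ≤ C ^ 2 * ‖f‖ ^ 2 := by rw [← mul_pow]; gcongr
  have hab2 : ‖a - b‖ ^ 2 ≤ 4 * C ^ 2 * ‖f‖ ^ 2 := by
    calc ‖a - b‖ ^ 2 ≤ (2 * C * ‖f‖) ^ 2 := by gcongr
      _ = 4 * C ^ 2 * ‖f‖ ^ 2 := by ring
  have hau : ∫ x in s, ‖a x‖ ^ 2 ≤ C * ‖f‖ ^ 2 / M := by
    refine (setIntegral_norm_sq_le hs hM hVM u).trans ?_
    gcongr
    have h1 := hu.norm_energyMap_sq_le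
    rw [norm_energyMap_sq] at h1
    nlinarith [sq_nonneg ‖weakDeriv u.1‖, norm_nonneg f]
  have hbw : ∫ x in s, ‖b x‖ ^ 2 ≤ C * ‖f‖ ^ 2 / M := by
    refine (setIntegral_norm_sq_le hs hM hWM w).trans ?_
    gcongr
    have h1 := hw.norm_energyMap_sq_le
    rw [norm_energyMap_sq] at h1
    nlinarith [sq_nonneg ‖weakDeriv w.1‖, norm_nonneg f]
  have hia := integrable_norm_sq a
  have hib := integrable_norm_sq b
  have hout : ∫ x in s, ‖(a - b) x‖ ^ 2 ≤ 4 * C / M * ‖f‖ ^ 2 := by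
    have h1 : ∫ x in s, ‖(a - b) x‖ ^ 2 ≤ ∫ x in s, (2 * ‖a x‖ ^ 2 + 2 * ‖b x‖ ^ 2) := by
      refine integral_mono_ae (integrable_norm_sq _).integrableOn
        ((hia.const_mul 2).fun_add (hib.const_mul 2)).integrableOn (ae_restrict_of_ae ?_)
      filter_upwards [Lp.coeFn_sub a b] with x hx
      rw [hx, Pi.sub_apply]
      have h2 : ‖a x - b x‖ ^ 2 ≤ (‖a x‖ + ‖b x‖) ^ 2 := by
        gcongr
        exact norm_sub_le _ _
      nlinarith [sq_nonneg (‖a x‖ - ‖b x‖)]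
    rw [integral_add (hia.const_mul 2).integrableOn (hib.const_mul 2).integrableOn,
      integral_const_mul, integral_const_mul] at h1
    have h3 : 4 * C / M * ‖f‖ ^ 2 = 4 * (C * ‖f‖ ^ 2 / M) := by ring
    linarith
  have hin : ∫ x in sᶜ, ‖(a - b) x‖ ^ 2 ≤ ‖testMul hχ.continuous hc (a - b)‖ ^ 2 := by
    have h1 : ∫ x in sᶜ, ‖(a - b) x‖ ^ 2 =
        ∫ x in sᶜ, ‖testMul hχ.continuous hc (a - b) x‖ ^ 2 := by
      refine setIntegral_congr_ae hs.compl ?_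
      filter_upwards [coeFn_testMul hχ.continuous hc (a - b)] with x hx hxs
      rw [hx, hχs x hxs, one_smul]
    rw [h1, norm_sq_eq_integral (testMul hχ.continuous hc (a - b))]
    exact setIntegral_le_integral (integrable_norm_sq _)
      (Eventually.of_forall fun x => sq_nonneg _)
  have hloc : ‖testMul hχ.continuous hc (a - b)‖ ^ 2 ≤
      (4 * C ^ 3 * κ ^ 2 + 5 * C ^ 3 * δ) * ‖f‖ ^ 2 := by
    calc ‖testMul hχ.continuous hc (a - b)‖ ^ 2
        ≤ C * (κ ^ 2 * ‖a - b‖ ^ 2 + δ * (‖a - b‖ ^ 2 + ‖b‖ ^ 2)) :=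
          hzC.trans (mul_le_mul_of_nonneg_left hzE hC)
      _ ≤ C * (κ ^ 2 * (4 * C ^ 2 * ‖f‖ ^ 2) +
            δ * (4 * C ^ 2 * ‖f‖ ^ 2 + C ^ 2 * ‖f‖ ^ 2)) := by gcongr
      _ = (4 * C ^ 3 * κ ^ 2 + 5 * C ^ 3 * δ) * ‖f‖ ^ 2 := by ring
  rw [norm_sq_eq_integral, ← integral_add_compl hs (integrable_norm_sq _)]
  linarith

theorem exists_cutoff (R : ℝ) {κ : ℝ} (hκ : 0 < κ) :
    ∃ χ : ℝ → ℝ, ContDiff ℝ ∞ χ ∧ HasCompactSupport χ ∧ (∀ x, |χ x| ≤ 1) ∧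
      (∀ x ∈ Ico (-R) R, χ x = 1) ∧ ∀ x, |deriv χ x| ≤ κ := by
  let ψ : ContDiffBump (0 : ℝ) := ⟨1, 2, one_pos, one_lt_two⟩
  have hψ : ContDiff ℝ ∞ ψ := ψ.contDiff
  obtain ⟨B, hB⟩ := ψ.hasCompactSupport.deriv.exists_bound_of_continuous
    (hψ.continuous_deriv (by simp))
  set L := max (max R (B / κ)) 1
  have hL : 0 < L := one_pos.trans_le (le_max_right _ _)
  have hRL : R ≤ L := (le_max_left _ _).trans (le_max_left _ _)
  have hBL : B / κ ≤ L := (le_max_right _ _).trans (le_max_left _ _)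
  refine ⟨fun x => ψ (L⁻¹ * x), hψ.comp (contDiff_const.mul contDiff_id), ?_, fun x => ?_,
    fun x hx => ?_, fun x => ?_⟩
  · exact ψ.hasCompactSupport.comp_homeomorph (Homeomorph.mulLeft₀ L⁻¹ (inv_ne_zero hL.ne'))
  · rw [abs_of_nonneg ψ.nonneg]
    exact ψ.le_one
  · refine ψ.one_of_mem_closedBall ?_
    rw [mem_closedBall_zero_iff, Real.norm_eq_abs, abs_mul, abs_of_pos (inv_pos.2 hL),
      inv_mul_le_iff₀ hL]
    show |x| ≤ L * 1
    rw [mul_one, abs_le]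
    exact ⟨by linarith [hx.1], by linarith [hx.2]⟩
  · have hd := ((hψ.differentiable (by simp) (L⁻¹ * x)).hasDerivAt).comp x
      ((hasDerivAt_id x).const_mul L⁻¹)
    have hd' : deriv (fun x => ψ (L⁻¹ * x)) x = deriv ψ (L⁻¹ * x) * (L⁻¹ * 1) := hd.deriv
    rw [hd', mul_one, abs_mul, abs_of_pos (inv_pos.2 hL), ← div_eq_mul_inv, div_le_iff₀ hL]
    have := hB (L⁻¹ * x)
    rw [Real.norm_eq_abs] at this
    rw [div_le_iff₀ hκ] at hBL
    linarith

theorem exists_forall_notMem_Ico {p : ℝ → Prop} (h : ∀ᶠ x in cocompact ℝ, p x) :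
    ∃ R₀ : ℝ, ∀ R, R₀ ≤ R → ∀ x ∉ Ico (-R) R, p x := by
  obtain ⟨K, hK, hKp⟩ := mem_cocompact.1 h
  obtain ⟨r, hr⟩ := hK.isBounded.subset_closedBall 0
  refine ⟨r + 1, fun R hR x hx => hKp fun hxK => hx ?_⟩
  have := hr hxK
  rw [mem_closedBall_zero_iff, Real.norm_eq_abs, abs_le] at this
  exact ⟨by linarith, by linarith⟩

/-- All the potentials with small parameter are large outside a common interval: by monotonicity
in the parameter, a single one of the lower bounds serves them all. -/
theorem exists_uniform_lower_bound {ε₀ : ℝ} (hε₀ : 0 < ε₀) {V : ℝ → ℝ≥0} {Vε : ℝ → ℝ → ℝ≥0}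
    {Vo : ℝ → ℝ → ℝ} (hV_top : Tendsto V (cocompact ℝ) atTop)
    (hge : ∀ ε ∈ Ioc 0 ε₀, ∀ x, Vo ε x ≤ (Vε ε x : ℝ))
    (hmono : ∀ ε₁ ∈ Ioc 0 ε₀, ∀ ε₂ ∈ Ioc 0 ε₀, ε₂ < ε₁ → ∀ x, Vo ε₁ x ≤ Vo ε₂ x)
    (hliminf : Tendsto (fun ε => liminf (fun x => ((Vo ε x : ℝ) : EReal)) (cocompact ℝ))
      (𝓝[>] 0) (𝓝 ⊤)) (M : ℝ) :
    ∃ R : ℝ, 0 ≤ R ∧ (∀ x ∉ Ico (-R) R, M ≤ V x) ∧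
      ∀ᶠ ε in 𝓝[>] (0 : ℝ), ∀ x ∉ Ico (-R) R, M ≤ Vε ε x := by
  have hIoc : ∀ᶠ ε in 𝓝[>] (0 : ℝ), ε ∈ Ioc 0 ε₀ := Ioc_mem_nhdsGT hε₀
  obtain ⟨ε₁, hε₁, hM⟩ := (hIoc.and (hliminf.eventually (lt_mem_nhds (EReal.coe_lt_top M)))).exists
  have hVo : ∀ᶠ x in cocompact ℝ, M ≤ Vo ε₁ x := by
    filter_upwards [eventually_lt_of_lt_liminf hM] with x hx
    exact (EReal.coe_lt_coe_iff.1 hx).le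
  have hV : ∀ᶠ x in cocompact ℝ, M ≤ V x := by
    filter_upwards [hV_top.eventually_ge_atTop M.toNNReal] with x hx
    exact (Real.le_coe_toNNReal M).trans (NNReal.coe_le_coe.2 hx)
  obtain ⟨R₁, hR₁⟩ := exists_forall_notMem_Ico (hVo.and hV)
  refine ⟨max R₁ 0, le_max_right _ _, fun x hx => (hR₁ _ (le_max_left _ _) x hx).2, ?_⟩
  filter_upwards [hIoc, Ioo_mem_nhdsGT hε₁.1] with ε hε hεε₁ x hx
  exact ((hR₁ _ (le_max_left _ _) x hx).1.trans (hmono ε₁ hε₁ ε hε hεε₁.2 x)).trans (hge ε hε x)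

end Schrodinger1D

theorem proposition3 {𝕜 : Type*} [RCLike 𝕜] (ε₀ : ℝ) (hε₀ : 0 < ε₀)
    (V : ℝ → ℝ≥0) (Vε : ℝ → ℝ → ℝ≥0) (Vo : ℝ → ℝ → ℝ)
    (hV : AEMeasurable V volume)
    (hVε : ∀ ε ∈ Ioc 0 ε₀, AEMeasurable (Vε ε) volume)
    (hVo : ∀ ε ∈ Ioc 0 ε₀, AEMeasurable (Vo ε) volume)
    (hV_top : Tendsto V (cocompact ℝ) atTop)
    (hconv : ∀ K : Set ℝ, IsCompact K → TendstoUniformlyOn Vε V (𝓝[>] 0) K)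
    (hge : ∀ ε ∈ Ioc 0 ε₀, ∀ x, Vo ε x ≤ (Vε ε x : ℝ))
    (hmono : ∀ ε₁ ∈ Ioc 0 ε₀, ∀ ε₂ ∈ Ioc 0 ε₀, ε₂ < ε₁ → ∀ x, Vo ε₁ x ≤ Vo ε₂ x)
    (hliminf : Tendsto (fun ε => liminf (fun x => ((Vo ε x : ℝ) : EReal)) (cocompact ℝ))
      (𝓝[>] 0) (𝓝 ⊤)) :
    ∃ (T : Schrodinger1D.L2 𝕜 →L[𝕜] Schrodinger1D.L2 𝕜)
      (Tε : ℝ → Schrodinger1D.L2 𝕜 →L[𝕜] Schrodinger1D.L2 𝕜),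
      Schrodinger1D.IsBoundedInverse (Schrodinger1D.schrodingerOp 𝕜 V) T ∧
      (∀ᶠ ε in 𝓝[>] 0,
        Schrodinger1D.IsBoundedInverse (Schrodinger1D.schrodingerOp 𝕜 (Vε ε)) (Tε ε)) ∧
      Tendsto (fun ε => ‖Tε ε - T‖) (𝓝[>] 0) (𝓝 0) := by
  open Schrodinger1D in
  have hlow := exists_uniform_lower_bound hε₀ hV_top hge hmono hliminf
  obtain ⟨R, hR, hVR, hVεR⟩ := hlow 1
  set C : ℝ := 3 + 8 * R ^ 2
  have hC : 0 < C := by positivity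
  have hVC : IsCoerciveForm 𝕜 V C := isCoerciveForm_of_one_le hR hVR
  have hVεC : ∀ᶠ ε in 𝓝[>] (0 : ℝ), IsCoerciveForm 𝕜 (Vε ε) C := by
    filter_upwards [hVεR] with ε hε
    exact isCoerciveForm_of_one_le hR hε
  obtain ⟨T, hT⟩ := hVC.exists_solution_operator hC.le
  -- for the parameters with a non-coercive form, the operator is irrelevant
  have hex : ∀ ε, ∃ S : L2 𝕜 →L[𝕜] L2 𝕜, IsCoerciveForm 𝕜 (Vε ε) C →
      ∀ f, ∃ u : formDomain 𝕜 (Vε ε), ((u : H1 𝕜) : L2 𝕜) = S f ∧ IsFormSolution (Vε ε) u f := by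
    intro ε
    by_cases h : IsCoerciveForm 𝕜 (Vε ε) C
    · obtain ⟨S, hS⟩ := h.exists_solution_operator hC.le
      exact ⟨S, fun _ => hS⟩
    · exact ⟨0, fun h' => absurd h' h⟩
  choose Tε hTε using hex
  refine ⟨T, Tε, isBoundedInverse_of_solution_operator hVC hT, ?_, ?_⟩
  · filter_upwards [hVεC] with ε hε
    exact isBoundedInverse_of_solution_operator hε (hTε ε hε)
  rw [Metric.tendsto_nhds]
  intro ρ hρ
  -- `η` bounds the slope of the cutoff, the distance of the potentials on the support of the
  -- cutoff, and the reciprocal of the potentials where the cutoff is not `1`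
  set A : ℝ := 9 * C ^ 3 + 4 * C
  have hA : 0 < A := by positivity
  obtain ⟨η, hη0, hη⟩ : ∃ η : ℝ, 0 < η ∧ η ≤ 1 ∧ A * η ≤ (ρ / 2) ^ 2 :=
    ⟨min 1 ((ρ / 2) ^ 2 / A), by positivity, min_le_left _ _, by
      rw [mul_comm, ← le_div_iff₀ hA]; exact min_le_right _ _⟩
  obtain ⟨R', -, hVR', hVεR'⟩ := hlow η⁻¹
  obtain ⟨χ, hχ, hc, hχ1, hχR, hχd⟩ := exists_cutoff R' hη0
  filter_upwards [hVεC, hVεR', Ioc_mem_nhdsGT hε₀,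
    Metric.tendstoUniformlyOn_iff.1 (hconv _ hc) η hη0] with ε hεC hεR hε hεK
  rw [dist_zero_right, norm_norm]
  refine lt_of_le_of_lt (ContinuousLinearMap.opNorm_le_bound _ (half_pos hρ).le fun f => ?_)
    (half_lt_self hρ)
  obtain ⟨u, hu, hus⟩ := hT f
  obtain ⟨w, hw, hws⟩ := hTε ε hεC f
  have hδ : ∀ x, χ x ≠ 0 → |(Vε ε x : ℝ) - V x| ≤ η := by
    intro x hx
    have := hεK x (subset_tsupport χ hx)
    rw [dist_comm, NNReal.dist_eq] at this
    exact this.le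
  have h := norm_sub_sq_le hV (hVε ε hε) hC.le hVC hεC hus hws measurableSet_Ico.compl
    (inv_pos.2 hη0) hVR' hεR hχ hc hχ1 (fun x hx => hχR x (not_not.1 hx)) hχd hη0.le hδ
  rw [sub_apply, ← hu, ← hw, norm_sub_rev]
  refine le_of_sq_le_sq ?_ (by positivity)
  calc ‖((u : H1 𝕜) : L2 𝕜) - ((w : H1 𝕜) : L2 𝕜)‖ ^ 2
      ≤ (4 * C ^ 3 * η ^ 2 + 5 * C ^ 3 * η + 4 * C / η⁻¹) * ‖f‖ ^ 2 := h
    _ ≤ (A * η) * ‖f‖ ^ 2 := by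
      gcongr
      have : C ^ 3 * η ^ 2 ≤ C ^ 3 * η := by
        gcongr
        nlinarith
      rw [div_inv_eq_mul]
      simp only [A]
      linarith
    _ ≤ (ρ / 2) ^ 2 * ‖f‖ ^ 2 := by
      gcongr
      exact hη.2
    _ = (ρ / 2 * ‖f‖) ^ 2 := by ring
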